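/- Let $X\subseteq\mathbb R^n$ be closed and convex, $\|\cdot\|$ the Euclidean norm, $f:\mathbb R^n\to\mathbb R$, $h$ convex on $X$, and $\Psi=f+h$ bounded below on $X$ with $\Psi^*=\inf_X\Psi$. Let $\omega$ be continuously differentiable on $X$ with $\langle x-z,\nabla\omega(x)-\nabla\omega(z)\rangle\ge\alpha\|x-z\|^2$ for $x,z\in X$, where $\alpha>0$, and put $V(x,z)=\omega(x)-\omega(z)-\langle\nabla\omega(z),x-z\rangle$. Assume that for all $x\in X$, $g\in\mathbb R^n$, $\gamma>0$ the problem $x^+=\arg\min_{u\in X}\{\langle g,u\rangle+\frac1\gamma V(u,x)+h(u)\}$ is solvable, and put $P_X(x,g,\gamma)=\frac1\gamma(x-x^+)$. Let $L>0$ and let $F(x,\xi)$ be Borel measurable. For each noise variable $\xi$ used below assume: $F(\cdot,\xi)$ is almost surely differentiable on $\mathbb R^n$ with $L$-Lipschitz gradient; $\mathbb E[F(x,\xi)]=f(x)$ for all $x\in\mathbb R^n$; and for all $x\in X$, $\mathbb E[\nabla_xF(x,\xi)]=\nabla f(x)$ and $\mathbb E\|\nabla_xF(x,\xi)-\nabla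 f(x)\|^2\le\sigma^2$. Assume also $\|\nabla f(x)\|\le M$ for all $x\in X$. Let $\mu>0$, $x_1\in X$, $N,m\ge1$. The randomized stochastic projected gradient free (RSPGF) algorithm with stepsizes $\gamma_k=\alpha/(2L)$ and batch sizes $m_k=m$, $k=1,\dots,N$, generates $$G_{\mu,k}=\frac1m\sum_{i=1}^m\frac{F(x_k+\mu v_{k,i},\xi_{k,i})-F(x_k,\xi_{k,i})}{\mu}\,v_{k,i},\qquad x_{k+1}=\arg\min_{u\in X}\Big\{\langle G_{\mu,k},u\rangle+\frac1{\gamma_k}V(u,x_k)+h(u)\Big\},$$ where the $v_{k,i}$ are standard Gaussian in $\mathbb R^n$, and $R\in\{1,\dots,N\}$ is random with $\mathrm{Prob}\{R=k\}=(\alpha\gamma_k-L\gamma_k^2)/\sum_{j=1}^N(\alpha\gamma_j-L\gamma_j^2)$; all $\xi_{k,i}$, $v_{k,i}$ and $R$ are mutually independent. Put $\bar g_{\mu,X,k}=P_X(x_k,G_{\mu,k},\gamma_k)$, $g_{X,k}=P_X(x_k,\nabla f(x_k),\gamma_k)$, $D_\Psi=[(\Psi(x_1)-\Psi^*)/L]^{1/2}$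 and $\tilde\sigma^2=2(n+4)[M^2+\sigma^2+\mu^2L^2(n+4)^2]$. Then the following expectations are finite and $$\mathbb E\|\bar g_{\mu,X,R}\|^2\le\frac{4L^2D_\Psi^2+4\mu^2L^2n}{\alpha^2N}+\frac{2\tilde\sigma^2}{\alpha^2m},$$ $$\mathbb E\|g_{X,R}\|^2\le\frac{\mu^2L^2(n+3)^2}{2\alpha^2}+\frac{16L^2D_\Psi^2+16\mu^2L^2n}{\alpha^2N}+\frac{12\tilde\sigma^2}{\alpha^2m}.$$ If, in addition, $f$ is convex on $\mathbb R^n$ and $x^*\in X$ minimizes $\Psi$ over $X$, then, with $x_{R+1}$ the iterate produced from $x_R$ by step $R$, also $\Psi(x_{R+1})-\Psi(x^*)$ is integrable and $$\mathbb E[\Psi(x_{R+1})-\Psi(x^*)]\le\frac{2LV(x^*,x_1)}{N\alpha}+\frac{\tilde\sigma^2}{2Lm}+\mu^2Ln.$$ -/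

import Mathlib

open MeasureTheory ProbabilityTheory
open scoped Gradient

namespace RSPGF

noncomputable section

/-- `ℝⁿ` with the standard Euclidean norm. -/
abbrev Vec (n : ℕ) : Type := EuclideanSpace ℝ (Fin n)

/-- The class `C_L^{1,1}(ℝⁿ)`. (A function with Lipschitz gradient has a continuous one.) -/
def IsC11 {n : ℕ} (L : ℝ) (φ : Vec n → ℝ) : Prop :=
  Differentiable ℝ φ ∧ ∀ x y : Vec n, ‖∇ φ y - ∇ φ x‖ ≤ L * ‖y - x‖

/-- `w` is a distance generating function on `X` with modulus `α`: it is continuously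
differentiable on `X`, with gradient `dw` on `X`, and strongly convex.
The gradient is taken within `X`, so `w` needs to be smooth only along `X`; on a convex set
`X` the numbers `⟪dw z, x - z⟫` with `x, z ∈ X`, the only ones that matter, are
determined by `w`. -/
structure IsDistanceGenerating {n : ℕ} (X : Set (Vec n)) (α : ℝ)
    (w : Vec n → ℝ) (dw : Vec n → Vec n) : Prop where
  hasGradient : ∀ x ∈ X, HasGradientWithinAt w (dw x) X x
  continuousOn : ContinuousOn dw X
  strong : ∀ x ∈ X, ∀ z ∈ X, α * ‖x - z‖ ^ 2 ≤ inner ℝ (x - z) (dw x - dw z)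

/-- The prox-function `V(x, z) = w(x) - [w(z) + ⟨∇w(z), x - z⟩]`. -/
def proxFun {n : ℕ} (w : Vec n → ℝ) (dw : Vec n → Vec n) (x z : Vec n) : ℝ :=
  w x - (w z + inner ℝ (dw z) (x - z))

/-- The objective `u ↦ ⟨g, u⟩ + V(u, x) / γ + h(u)` of the generalized projection. -/
def projObjective {n : ℕ} (w : Vec n → ℝ) (dw : Vec n → Vec n) (h : Vec n → ℝ)
    (x g : Vec n) (γ : ℝ) (u : Vec n) : ℝ :=
  inner ℝ g u + (1 / γ) * proxFun w dw u x + h u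

/-- `u` solves the generalized projection problem over `X`. -/
def IsGenProj {n : ℕ} (X : Set (Vec n)) (w : Vec n → ℝ) (dw : Vec n → Vec n)
    (h : Vec n → ℝ) (x g : Vec n) (γ : ℝ) (u : Vec n) : Prop :=
  u ∈ X ∧ IsMinOn (projObjective w dw h x g γ) X u

/-- The generalized projection `x⁺ = argmin_{u ∈ X} {⟨g, u⟩ + V(u, x) / γ + h(u)}`. -/
def genProj {n : ℕ} (X : Set (Vec n)) (w : Vec n → ℝ) (dw : Vec n → Vec n)
    (h : Vec n → ℝ) (x g : Vec n) (γ : ℝ) : Vec n :=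
  Classical.epsilon (IsGenProj X w dw h x g γ)

/-- The generalized projected gradient `P_X(x, g, γ) = (x - x⁺) / γ`. -/
def projGrad {n : ℕ} (X : Set (Vec n)) (w : Vec n → ℝ) (dw : Vec n → Vec n)
    (h : Vec n → ℝ) (x g : Vec n) (γ : ℝ) : Vec n :=
  (1 / γ) • (x - genProj X w dw h x g γ)

/-- The objective `Ψ = f + h`. -/
def Psi {n : ℕ} (f h : Vec n → ℝ) (x : Vec n) : ℝ := f x + h x

/-- `D_Ψ = [(Ψ(x₁) - Ψ^*) / L]^{1/2}`, with `Ψ^*` the infimum of `Ψ` over `X`. -/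
def DPsi {n : ℕ} (X : Set (Vec n)) (f h : Vec n → ℝ) (L : ℝ) (x₁ : Vec n) : ℝ :=
  Real.sqrt ((Psi f h x₁ - sInf (Psi f h '' X)) / L)

/-- The assumptions on one call of the stochastic zeroth-order oracle whose noise has law `ν`:
`F(·, ξ)` is almost surely in `C_L^{1,1}(ℝⁿ)`, `F(x, ξ)` is an unbiased estimator of `f(x)`, and
on `X` the stochastic gradient `G(x, ξ) = ∇ₓF(x, ξ)` is an unbiased estimator of `∇f(x)` with
variance at most `σ²`. -/
structure IsOracle {n : ℕ} {Ξ : Type*} [MeasurableSpace Ξ] (X : Set (Vec n))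
    (f : Vec n → ℝ) (F : Vec n → Ξ → ℝ) (L σ : ℝ) (ν : Measure Ξ) : Prop where
  smooth : ∀ᵐ z ∂ν, IsC11 L (fun x => F x z)
  integrable_value : ∀ x, Integrable (fun z => F x z) ν
  mean_value : ∀ x, ∫ z, F x z ∂ν = f x
  integrable_grad : ∀ x ∈ X, Integrable (fun z => ∇ (fun y => F y z) x) ν
  mean_grad : ∀ x ∈ X, ∫ z, ∇ (fun y => F y z) x ∂ν = ∇ f x
  integrable_variance : ∀ x ∈ X, Integrable (fun z => ‖∇ (fun y => F y z) x - ∇ f x‖ ^ 2) ν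
  variance_le : ∀ x ∈ X, ∫ z, ‖∇ (fun y => F y z) x - ∇ f x‖ ^ 2 ∂ν ≤ σ ^ 2

/-- `G_μ(x, ξ, v) = [F(x + μv, ξ) - F(x, ξ)] / μ · v`. -/
def gradEst {n : ℕ} {Ξ : Type*} (F : Vec n → Ξ → ℝ) (μ : ℝ) (x : Vec n) (z : Ξ)
    (v : Vec n) : Vec n :=
  ((F (x + μ • v) z - F x z) / μ) • v

/-- The mini-batch average `(1/m) ∑_{i < m} G_μ(x, ξ_i, v_i)`. -/
def batchEst {n : ℕ} {Ξ : Type*} (F : Vec n → Ξ → ℝ) (μ : ℝ) (m : ℕ) (x : Vec n)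
    (z : ℕ → Ξ) (v : ℕ → Vec n) : Vec n :=
  (1 / (m : ℝ)) • ∑ i ∈ Finset.range m, gradEst F μ x (z i) (v i)

/-- The iterates `x_1, x_2, …` of the RSPGF algorithm along a realisation `z k i`, `v k i` of the
noise and of the directions: `x_1 = x₁` and
`x_{k+1} = argmin_{u ∈ X} {⟨G_{μ,k}, u⟩ + V(u, x_k) / γ_k + h(u)}` for `k ≥ 1`, where `G_{μ,k}` is
the average of the `m_k` samples of step `k`. (The value at index `0` is not used.) -/
def iterate {n : ℕ} {Ξ : Type*} (X : Set (Vec n)) (w : Vec n → ℝ) (dw : Vec n → Vec n)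
    (h : Vec n → ℝ) (F : Vec n → Ξ → ℝ) (μ : ℝ) (γ : ℕ → ℝ) (m : ℕ → ℕ) (x₁ : Vec n)
    (z : ℕ → ℕ → Ξ) (v : ℕ → ℕ → Vec n) : ℕ → Vec n
  | 0 => x₁
  | 1 => x₁
  | k + 2 =>
    genProj X w dw h (iterate X w dw h F μ γ m x₁ z v (k + 1))
      (batchEst F μ (m (k + 1)) (iterate X w dw h F μ γ m x₁ z v (k + 1)) (z (k + 1)) (v (k + 1)))
      (γ (k + 1))

/-- `P_R(k) = (α γ_k - L γ_k²) / ∑_{j=1}^N (α γ_j - L γ_j²)`. -/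
def stopProb (α L : ℝ) (γ : ℕ → ℝ) (N k : ℕ) : ℝ :=
  (α * γ k - L * γ k ^ 2) / ∑ j ∈ Finset.Icc 1 N, (α * γ j - L * γ j ^ 2)

/-- `σ̃² = 2(n+4)[M² + σ² + μ²L²(n+4)²]`. -/
def sigmaTildeSq (n : ℕ) (M σ μ L : ℝ) : ℝ :=
  2 * ((n : ℝ) + 4) * (M ^ 2 + σ ^ 2 + μ ^ 2 * L ^ 2 * ((n : ℝ) + 4) ^ 2)

/-- The random inputs of a run of the algorithm with iteration limit `N`: noises `ξ k i`, standard
Gaussian directions `v k i` and the random index `R` with probability mass function `P_R`, all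
mutually independent. -/
structure IsSampling {n : ℕ} {Ξ Ω : Type*} [MeasurableSpace Ξ] [MeasurableSpace Ω]
    (P : Measure Ω) (α L : ℝ) (γ : ℕ → ℝ) (N : ℕ)
    (ξ : ℕ → ℕ → Ω → Ξ) (v : ℕ → ℕ → Ω → Vec n) (R : Ω → ℕ) : Prop where
  measurable_noise : ∀ k i, Measurable (ξ k i)
  measurable_dir : ∀ k i, Measurable (v k i)
  measurable_index : Measurable R
  law_dir : ∀ k i, P.map (v k i) = stdGaussian (Vec n)
  law_index : ∀ k ∈ Finset.Icc 1 N, P {s | R s = k} = ENNReal.ofReal (stopProb α L γ N k)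
  indep_noise_dir : ∀ k i, IndepFun (ξ k i) (v k i) P
  indep_samples : iIndepFun (fun (p : ℕ × ℕ) s => (ξ p.1 p.2 s, v p.1 p.2 s)) P
  indep_index : IndepFun (fun s (p : ℕ × ℕ) => (ξ p.1 p.2 s, v p.1 p.2 s)) R P

end

end RSPGF

-- The algorithm never sees `∇f`, but it is an exact stochastic projected gradient method for a
-- nearby function: the Gaussian smoothing `f_μ(x) = 𝔼 f(x + μv)`. Averaging the quadratic expansion
-- of `f` shows that `f_μ` is again `C^{1,1}` with the same `L` and that `|f_μ - f| ≤ Lμ²n/2`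
-- (`IsC11.smoothing`, `IsC11.abs_smoothing_sub_le`). Stein's identity makes the finite-difference
-- estimator unbiased for `∇f_μ` (`IsC11.integral_quotient_smul`, `IsOracle.integral_gradEst`), and
-- the Gaussian moments bound its second moment on `X` by `σ̃²`
-- (`IsOracle.integrable_norm_gradEst_sq`). Distinct samples have orthogonal errors, so a batch
-- error `δ_k = G_k - ∇f_μ(x_k)` has mean square at most `σ̃²/m`, and it is orthogonal to everything
-- determined by earlier steps.
--
-- With `γ = α/(2L)`, `descent_step` lowers `Ψ_μ = f_μ + h` by `α²/(4L)` times the squared projected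
-- gradient, up to `‖δ_k‖²/(2L)` and a term of mean zero. Telescoping between `Ψ(x₁) + Lμ²n/2` and
-- `Ψ^* - Lμ²n/2` bounds the sum over the run, and since the stepsizes are constant, `R` is uniform
-- and turns the sum into an average. The bound for the exact gradient follows because the
-- generalized projected gradient is `1/α`-Lipschitz in its gradient argument. In the convex case
-- `convex_step` telescopes the prox-function instead.
--
-- Two points need care. Expectations of the mean-zero terms make sense only once their factors are
-- known to be square integrable, which is proved along the run by induction. Measurability of the
-- iterates comes from continuity of the generalized projection on `X × ℝⁿ`, a consequence of strong
-- monotonicity of `dw`.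

namespace RSPGF

-- One-variable estimates and functions with Lipschitz gradient.

section

/-- If `ψ' t ≤ K t` on `[0, 1]` then `ψ 1 - ψ 0 ≤ K / 2`. -/
lemma sub_le_half_of_deriv_le_mul {ψ ψ' : ℝ → ℝ} {K : ℝ}
    (hd : ∀ t ∈ Set.Icc (0 : ℝ) 1, HasDerivWithinAt ψ (ψ' t) (Set.Icc 0 1) t)
    (hb : ∀ t ∈ Set.Icc (0 : ℝ) 1, ψ' t ≤ K * t) : ψ 1 - ψ 0 ≤ K / 2 := by
  have h1 : ∀ t ∈ Set.Icc (0 : ℝ) 1,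
      HasDerivWithinAt (fun t => ψ t - K / 2 * t ^ 2) (ψ' t - K * t) (Set.Icc 0 1) t := by
    intro t ht
    refine ((hd t ht).sub (((hasDerivAt_pow 2 t).const_mul (K / 2)).hasDerivWithinAt)).congr_deriv ?_
    simp; ring
  have h2 : AntitoneOn (fun t => ψ t - K / 2 * t ^ 2) (Set.Icc 0 1) := by
    apply antitoneOn_of_hasDerivWithinAt_nonpos (convex_Icc 0 1)
      (fun t ht => (h1 t ht).continuousWithinAt)
      (f' := fun t => ψ' t - K * t)
    · intro t ht
      exact (h1 t (interior_subset ht)).mono interior_subset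
    · intro t ht
      linarith [hb t (interior_subset ht)]
  have := h2 (Set.left_mem_Icc.2 zero_le_one) (Set.right_mem_Icc.2 zero_le_one) zero_le_one
  simp at this
  linarith

/-- If `ψ t - ψ 0 ≤ t c` on `[0, 1]` then the right derivative of `ψ` at `0` is at most `c`. -/
lemma deriv_le_of_sub_le_mul {ψ : ℝ → ℝ} {d c : ℝ}
    (hd : HasDerivWithinAt ψ d (Set.Icc 0 1) 0)
    (hb : ∀ t ∈ Set.Ioc (0 : ℝ) 1, ψ t - ψ 0 ≤ t * c) : d ≤ c := by
  have h1 := hd.mono Set.Ioc_subset_Icc_self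
  rw [hasDerivWithinAt_iff_tendsto_slope' (by simp)] at h1
  have hne : (nhdsWithin (0 : ℝ) (Set.Ioc 0 1)).NeBot := by
    rw [nhdsWithin_Ioc_eq_nhdsGT zero_lt_one]; infer_instance
  refine le_of_tendsto h1 ?_
  filter_upwards [self_mem_nhdsWithin] with t ht
  rw [slope_def_field, sub_zero, div_le_iff₀ ht.1]
  linarith [hb t ht]

variable {n : ℕ}

lemma hasDerivWithinAt_comp_segment {X : Set (Vec n)} (hX : Convex ℝ X) {φ : Vec n → ℝ}
    {x y p : Vec n} {t : ℝ} (hx : x ∈ X) (hy : y ∈ X)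
    (hφ : HasGradientWithinAt φ p X (x + t • (y - x))) :
    HasDerivWithinAt (fun t : ℝ => φ (x + t • (y - x))) (inner ℝ p (y - x)) (Set.Icc 0 1) t := by
  have h1 : HasDerivWithinAt (fun t : ℝ => x + t • (y - x)) (y - x) (Set.Icc 0 1) t := by
    simpa using (((hasDerivAt_id t).smul_const (y - x)).const_add x).hasDerivWithinAt
  have h2 := hφ.hasFDerivWithinAt.comp_hasDerivWithinAt t h1 (fun s hs => by
    have := hX.add_smul_sub_mem hx hy hs
    exact this)
  exact h2.congr_deriv (by simp)

lemma IsC11.hasGradientAt {L : ℝ} {φ : Vec n → ℝ} (hφ : IsC11 L φ) (x : Vec n) :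
    HasGradientAt φ (∇ φ x) x := (hφ.1 x).hasGradientAt

lemma IsC11.continuous_gradient {L : ℝ} {φ : Vec n → ℝ} (hφ : IsC11 L φ) :
    Continuous (∇ φ) := by
  rcases le_or_gt 0 L with hL | hL
  · refine (LipschitzWith.of_dist_le_mul (K := ⟨L, hL⟩) fun x y => ?_).continuous
    rw [dist_eq_norm, dist_eq_norm]; exact hφ.2 y x
  -- `IsC11` does not ask for `L ≥ 0`; a negative `L` forces the gradient to be constant.
  · refine (LipschitzWith.of_dist_le_mul (K := 0) fun x y => ?_).continuous
    rw [dist_eq_norm]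
    refine (hφ.2 y x).trans ?_
    simpa using mul_nonpos_of_nonpos_of_nonneg hL.le (norm_nonneg (x - y))

/-- The descent lemma. -/
lemma IsC11.sub_le {L : ℝ} {φ : Vec n → ℝ} (hφ : IsC11 L φ) (x y : Vec n) :
    φ y - φ x - inner ℝ (∇ φ x) (y - x) ≤ L / 2 * ‖y - x‖ ^ 2 := by
  have := sub_le_half_of_deriv_le_mul (K := L * ‖y - x‖ ^ 2)
    (ψ := fun t => φ (x + t • (y - x)) - t * inner ℝ (∇ φ x) (y - x))
    (ψ' := fun t => inner ℝ (∇ φ (x + t • (y - x))) (y - x) - inner ℝ (∇ φ x) (y - x))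
    (fun t _ => by
      refine (hasDerivWithinAt_comp_segment convex_univ (Set.mem_univ x) (Set.mem_univ y)
        (hφ.hasGradientAt _).hasFDerivAt.hasFDerivWithinAt).sub ?_
      simpa using ((hasDerivAt_id t).mul_const (inner ℝ (∇ φ x) (y - x))).hasDerivWithinAt)
    (fun t ht => by
      rw [← inner_sub_left]
      refine (real_inner_le_norm _ _).trans ?_
      have h1 := hφ.2 x (x + t • (y - x))
      rw [add_sub_cancel_left, norm_smul, Real.norm_of_nonneg ht.1] at h1
      nlinarith [norm_nonneg (y - x)])
  simp only [one_smul, one_mul, zero_smul, zero_mul, add_zero, add_sub_cancel, sub_zero] at this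
  linarith

lemma IsC11.neg {L : ℝ} {φ : Vec n → ℝ} (hφ : IsC11 L φ) :
    IsC11 L (fun x => - φ x) ∧ ∀ x, ∇ (fun x => - φ x) x = - ∇ φ x := by
  have h : ∀ x, ∇ (fun x => - φ x) x = - ∇ φ x := fun x => by
    apply HasGradientAt.gradient
    have := (hφ.hasGradientAt x).hasFDerivAt.neg
    rw [hasGradientAt_iff_hasFDerivAt]
    exact this.congr_fderiv (map_neg (InnerProductSpace.toDual ℝ (Vec n)) _).symm
  refine ⟨⟨hφ.1.neg, fun x y => ?_⟩, h⟩
  rw [h, h, neg_sub_neg, norm_sub_rev]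
  exact hφ.2 x y

lemma IsC11.abs_sub_le {L : ℝ} {φ : Vec n → ℝ} (hφ : IsC11 L φ) (x y : Vec n) :
    |φ y - φ x - inner ℝ (∇ φ x) (y - x)| ≤ L / 2 * ‖y - x‖ ^ 2 := by
  rw [abs_le]
  have h1 := hφ.sub_le x y
  have h2 := hφ.neg.1.sub_le x y
  rw [hφ.neg.2, inner_neg_left] at h2
  constructor <;> linarith

/-- A quadratic expansion with Lipschitz linear part makes a function `C^{1,1}`. -/
lemma isC11_of_abs_sub_le {L : ℝ} {φ : Vec n → ℝ} {p : Vec n → Vec n}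
    (hq : ∀ x y, |φ y - φ x - inner ℝ (p x) (y - x)| ≤ L / 2 * ‖y - x‖ ^ 2)
    (hp : ∀ x y, ‖p y - p x‖ ≤ L * ‖y - x‖) : IsC11 L φ ∧ ∇ φ = p := by
  have h : ∀ x, HasGradientAt φ (p x) x := fun x => by
    rw [hasGradientAt_iff_isLittleO]
    have h1 : (fun y => φ y - φ x - inner ℝ (p x) (y - x)) =O[nhds x]
        fun y => ‖y - x‖ ^ 2 := by
      refine Asymptotics.IsBigO.of_bound (L / 2) (Filter.Eventually.of_forall fun y => ?_)
      simpa using hq x y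
    refine h1.trans_isLittleO ?_
    have h2 : Filter.Tendsto (fun y => ‖y - x‖) (nhds x) (nhds 0) := by
      have : Continuous fun y => ‖y - x‖ := by fun_prop
      simpa using this.tendsto x
    have h3 := (Asymptotics.isLittleO_pow_id (𝕜 := ℝ) (n := 2) one_lt_two).comp_tendsto h2
    exact (Asymptotics.isLittleO_norm_right.1 h3)
  have hg : ∇ φ = p := funext fun x => (h x).gradient
  exact ⟨⟨fun x => (h x).differentiableAt, by rwa [hg]⟩, hg⟩

/-- The gradient inequality for differentiable convex functions. -/
lemma add_inner_le_of_convexOn {φ : Vec n → ℝ} (hφ : ConvexOn ℝ Set.univ φ) {x p : Vec n}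
    (hp : HasGradientAt φ p x) (y : Vec n) : φ x + inner ℝ p (y - x) ≤ φ y := by
  have h1 : HasDerivWithinAt (fun t : ℝ => φ (x + t • (y - x))) (inner ℝ p (y - x))
      (Set.Icc 0 1) 0 :=
    hasDerivWithinAt_comp_segment convex_univ (Set.mem_univ x) (Set.mem_univ y)
      (by rw [zero_smul, add_zero]; exact hp.hasFDerivAt.hasFDerivWithinAt)
  have := deriv_le_of_sub_le_mul h1 (c := φ y - φ x) (fun t ht => by
    have h2 := hφ.2 (Set.mem_univ x) (Set.mem_univ y) (sub_nonneg.2 ht.2) ht.1.le (by ring)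
    have h3 : (1 - t) • x + t • y = x + t • (y - x) := by module
    rw [h3] at h2
    simp at h2 ⊢
    linarith)
  linarith

end

-- The generalized projection: optimality, stability, measurability.

section

variable {n : ℕ} {X : Set (Vec n)} {α : ℝ} {w : Vec n → ℝ} {dw : Vec n → Vec n} {h : Vec n → ℝ}

/-- Along the segment from `z` to `x` the derivative of `t ↦ V(z + t(x - z), z)` is at least `αt‖x -
z‖²`: strong monotonicity between `z + t(x - z)` and `z` gives this with an extra factor `t` on both
sides, so `t = 0` is separated. The signs are flipped to use the upper estimate
`sub_le_half_of_deriv_le_mul`. -/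
lemma IsDistanceGenerating.le_proxFun (hw : IsDistanceGenerating X α w dw) (hX : Convex ℝ X)
    {x z : Vec n} (hx : x ∈ X) (hz : z ∈ X) : α / 2 * ‖x - z‖ ^ 2 ≤ proxFun w dw x z := by
  have := sub_le_half_of_deriv_le_mul (K := - (α * ‖x - z‖ ^ 2))
    (ψ := fun t => -(w (z + t • (x - z)) - t * inner ℝ (dw z) (x - z)))
    (ψ' := fun t => -(inner ℝ (dw (z + t • (x - z))) (x - z) - inner ℝ (dw z) (x - z)))
    (fun t ht => by
      refine ((hasDerivWithinAt_comp_segment hX hz hx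
        (hw.hasGradient _ (hX.add_smul_sub_mem hz hx ht))).sub ?_).neg
      simpa using ((hasDerivAt_id t).mul_const (inner ℝ (dw z) (x - z))).hasDerivWithinAt)
    (fun t ht => by
      rw [← inner_sub_left]
      rcases ht.1.eq_or_lt with rfl | h0
      · simp
      have h1 := hw.strong _ (hX.add_smul_sub_mem hz hx ht) _ hz
      rw [add_sub_cancel_left, norm_smul, Real.norm_of_nonneg ht.1, inner_smul_left] at h1
      simp only [conj_trivial] at h1
      rw [real_inner_comm] at h1
      have h2 : t * (α * t * ‖x - z‖ ^ 2) ≤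
          t * inner ℝ (dw (z + t • (x - z)) - dw z) (x - z) := by linarith
      have := le_of_mul_le_mul_left h2 h0
      linarith)
  simp only [one_smul, one_mul, zero_smul, zero_mul, add_zero, add_sub_cancel, sub_zero] at this
  unfold proxFun
  linarith

lemma IsDistanceGenerating.proxFun_nonneg (hw : IsDistanceGenerating X α w dw) (hX : Convex ℝ X)
    (hα : 0 < α) {x z : Vec n} (hx : x ∈ X) (hz : z ∈ X) : 0 ≤ proxFun w dw x z :=
  le_trans (by positivity) (hw.le_proxFun hX hx hz)

/-- The first order optimality condition of the generalized projection. -/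
lemma IsGenProj.optimality (hw : IsDistanceGenerating X α w dw) (hX : Convex ℝ X)
    (hh : ConvexOn ℝ X h) {x g u y : Vec n} {γ : ℝ} (hu : IsGenProj X w dw h x g γ u)
    (hy : y ∈ X) :
    0 ≤ inner ℝ (g + (1 / γ) • (dw u - dw x)) (y - u) + h y - h u := by
  -- Only the smooth part of the objective is differentiated. Minimality at `u` bounds its decrease
  -- by the increase of `h`, and convexity bounds that by `t (h y - h u)`.
  set ψ : ℝ → ℝ := fun t => -(inner ℝ g (u + t • (y - u)) +
    (1 / γ) * proxFun w dw (u + t • (y - u)) x) with hψ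
  have hlin : ∀ p q : Vec n, HasDerivWithinAt (fun t : ℝ => inner ℝ p (u + t • (y - u) - q))
      (inner ℝ p (y - u)) (Set.Icc 0 1) 0 := fun p q => by
    have h1 : HasDerivAt (fun t : ℝ => u + t • (y - u) - q) (y - u) 0 := by
      simpa using (((hasDerivAt_id (0 : ℝ)).smul_const (y - u)).const_add u).sub_const q
    simpa using ((hasDerivAt_const (0 : ℝ) p).inner ℝ h1).hasDerivWithinAt
  have hd : HasDerivWithinAt ψ (-(inner ℝ (g + (1 / γ) • (dw u - dw x)) (y - u)))
      (Set.Icc 0 1) 0 := by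
    have h1 : HasDerivWithinAt (fun t : ℝ => w (u + t • (y - u))) (inner ℝ (dw u) (y - u))
        (Set.Icc 0 1) 0 := hasDerivWithinAt_comp_segment hX hu.1 hy
      (by rw [zero_smul, add_zero]; exact hw.hasGradient _ hu.1)
    have h2 := hlin g 0
    simp only [sub_zero] at h2
    have h3 := ((h2.add ((h1.sub ((hlin (dw x) x).const_add (w x))).const_mul (1 / γ)))).neg
    refine h3.congr_deriv ?_
    rw [inner_add_left, inner_smul_left, inner_sub_left]
    simp
  have := deriv_le_of_sub_le_mul hd (c := h y - h u) (fun t ht => by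
    have ht' : t ∈ Set.Icc (0 : ℝ) 1 := ⟨ht.1.le, ht.2⟩
    have h1 := hu.2 (hX.add_smul_sub_mem hu.1 hy ht')
    have h2 := hh.2 hu.1 hy (sub_nonneg.2 ht.2) ht.1.le (by ring)
    have h3 : (1 - t) • u + t • y = u + t • (y - u) := by module
    rw [h3] at h2
    simp only [projObjective, Set.mem_ofPred_eq] at h1
    simp only [hψ, zero_smul, add_zero]
    simp only [smul_eq_mul] at h2
    linarith)
  linarith

lemma isGenProj_genProj {x g : Vec n} {γ : ℝ} (hex : ∃ u, IsGenProj X w dw h x g γ u) :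
    IsGenProj X w dw h x g γ (genProj X w dw h x g γ) := Classical.epsilon_spec hex

/-- The optimality condition tested at `x` itself, combined with strong monotonicity between `x` and
`u`. -/
lemma IsGenProj.le_inner (hw : IsDistanceGenerating X α w dw) (hX : Convex ℝ X)
    (hh : ConvexOn ℝ X h) {x g u : Vec n} {γ : ℝ} (hγ : 0 < γ) (hx : x ∈ X)
    (hu : IsGenProj X w dw h x g γ u) :
    α / γ * ‖x - u‖ ^ 2 + h u - h x ≤ inner ℝ g (x - u) := by
  have h1 := hu.optimality hw hX hh hx
  have h2 := hw.strong x hx u hu.1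
  rw [inner_add_left, inner_smul_left, real_inner_comm] at h1
  simp only [conj_trivial] at h1
  have h4 : inner ℝ (dw u - dw x) (x - u) = - inner ℝ (x - u) (dw x - dw u) := by
    rw [← neg_sub (dw x) (dw u), inner_neg_left, real_inner_comm]
  rw [h4] at h1
  have h3 : (1 / γ) * (α * ‖x - u‖ ^ 2) ≤ (1 / γ) * inner ℝ (x - u) (dw x - dw u) :=
    mul_le_mul_of_nonneg_left h2 (by positivity)
  have h5 : α / γ * ‖x - u‖ ^ 2 = (1 / γ) * (α * ‖x - u‖ ^ 2) := by ring
  rw [real_inner_comm] at h1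
  linarith

/-- The three-point inequality of the generalized projection. -/
lemma IsGenProj.three_point (hw : IsDistanceGenerating X α w dw) (hX : Convex ℝ X)
    (hh : ConvexOn ℝ X h) {x g u y : Vec n} {γ : ℝ}
    (hu : IsGenProj X w dw h x g γ u) (hy : y ∈ X) :
    inner ℝ g (u - y) + h u - h y ≤
      (1 / γ) * (proxFun w dw y x - proxFun w dw u x - proxFun w dw y u) := by
  have h1 := hu.optimality hw hX hh hy
  have h2 : proxFun w dw y x - proxFun w dw u x - proxFun w dw y u =
      inner ℝ (dw u - dw x) (y - u) := by
    simp only [proxFun, inner_sub_left, inner_sub_right]; ring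
  rw [h2]
  rw [inner_add_left, inner_smul_left] at h1
  simp only [conj_trivial] at h1
  have h3 : inner ℝ g (u - y) = - inner ℝ g (y - u) := by
    rw [← neg_sub y u, inner_neg_right]
  linarith

/-- Testing each optimality condition at the other solution and adding cancels `h`; strong
monotonicity of `dw` then controls `‖u - u'‖²`. Besides stability in `g` and `x` this gives
uniqueness, so the choice made in `genProj` is immaterial. -/
lemma IsGenProj.norm_sub_le (hw : IsDistanceGenerating X α w dw) (hX : Convex ℝ X)
    (hα : 0 < α) (hh : ConvexOn ℝ X h) {x g u x' g' u' : Vec n} {γ : ℝ} (hγ : 0 < γ)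
    (hu : IsGenProj X w dw h x g γ u) (hu' : IsGenProj X w dw h x' g' γ u') :
    ‖u - u'‖ ≤ γ / α * ‖g - g'‖ + 1 / α * ‖dw x - dw x'‖ := by
  have h1 := hu.optimality hw hX hh hu'.1
  have h2 := hu'.optimality hw hX hh hu.1
  have h3 := hw.strong u hu.1 u' hu'.1
  have e : inner ℝ (g + (1 / γ) • (dw u - dw x)) (u' - u) +
      inner ℝ (g' + (1 / γ) • (dw u' - dw x')) (u - u') =
      - inner ℝ (g - g') (u - u') - (1 / γ) * inner ℝ (u - u') (dw u - dw u') +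
      (1 / γ) * inner ℝ (dw x - dw x') (u - u') := by
    rw [real_inner_comm (dw u - dw u')]
    simp only [inner_add_left, inner_smul_left, inner_sub_left, inner_sub_right, conj_trivial]
    ring
  have h4 : (1 / γ) * (α * ‖u - u'‖ ^ 2) ≤ (1 / γ) * inner ℝ (u - u') (dw u - dw u') :=
    mul_le_mul_of_nonneg_left h3 (by positivity)
  have h5 : - inner ℝ (g - g') (u - u') ≤ ‖g - g'‖ * ‖u - u'‖ :=
    (neg_le_abs _).trans (abs_real_inner_le_norm _ _)
  have h6 : (1 / γ) * inner ℝ (dw x - dw x') (u - u') ≤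
      (1 / γ) * (‖dw x - dw x'‖ * ‖u - u'‖) :=
    mul_le_mul_of_nonneg_left (real_inner_le_norm _ _) (by positivity)
  have h7 : (1 / γ) * (α * ‖u - u'‖ ^ 2) ≤
      ‖g - g'‖ * ‖u - u'‖ + (1 / γ) * (‖dw x - dw x'‖ * ‖u - u'‖) := by linarith
  rcases (norm_nonneg (u - u')).eq_or_lt with h0 | h0
  · rw [← h0]; positivity
  · have h8 : (α / γ * ‖u - u'‖) * ‖u - u'‖ ≤
        (‖g - g'‖ + 1 / γ * ‖dw x - dw x'‖) * ‖u - u'‖ := by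
      have : (α / γ * ‖u - u'‖) * ‖u - u'‖ = (1 / γ) * (α * ‖u - u'‖ ^ 2) := by ring
      rw [this]; linarith
    have h9 := le_of_mul_le_mul_right h8 h0
    have h10 := mul_le_mul_of_nonneg_left h9 (by positivity : 0 ≤ γ / α)
    have h11 : γ / α * (α / γ * ‖u - u'‖) = ‖u - u'‖ := by field_simp
    have h12 : γ / α * (‖g - g'‖ + 1 / γ * ‖dw x - dw x'‖) =
        γ / α * ‖g - g'‖ + 1 / α * ‖dw x - dw x'‖ := by field_simp
    linarith

/-- A convex `h` may jump at the boundary of `X`. Along solutions of projection problems it cannot,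
since each optimality condition supplies a subgradient inequality for `h`. -/
lemma IsGenProj.abs_sub_le (hw : IsDistanceGenerating X α w dw) (hX : Convex ℝ X)
    (hh : ConvexOn ℝ X h) {x g u x' g' u' : Vec n} {γ : ℝ}
    (hu : IsGenProj X w dw h x g γ u) (hu' : IsGenProj X w dw h x' g' γ u') :
    |h u - h u'| ≤ (‖g + (1 / γ) • (dw u - dw x)‖ + ‖g' + (1 / γ) • (dw u' - dw x')‖) *
      ‖u - u'‖ := by
  have h1 := hu.optimality hw hX hh hu'.1
  have h2 := hu'.optimality hw hX hh hu.1
  have h3 := real_inner_le_norm (g + (1 / γ) • (dw u - dw x)) (u' - u)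
  have h4 := real_inner_le_norm (g' + (1 / γ) • (dw u' - dw x')) (u - u')
  rw [norm_sub_rev] at h3
  have h5 := mul_nonneg (norm_nonneg (g + (1 / γ) • (dw u - dw x))) (norm_nonneg (u - u'))
  have h6 := mul_nonneg (norm_nonneg (g' + (1 / γ) • (dw u' - dw x'))) (norm_nonneg (u - u'))
  rw [abs_le]
  constructor <;> linarith

/-- The point is treated as an element of the subtype `X` because `dw`, and with it the projection,
is continuous only along `X`. -/
lemma measurable_comp_of_continuous_subtype_prod {E Ω : Type*} [TopologicalSpace E]
    [MeasurableSpace E] [BorelSpace E] [MeasurableSpace Ω] {Φ : X × Vec n → E}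
    (hΦ : Continuous Φ) {x g : Ω → Vec n} (hx : Measurable x) (hg : Measurable g)
    (hxX : ∀ s, x s ∈ X) : Measurable fun s => Φ (⟨x s, hxX s⟩, g s) := by
  have h2 : Measurable fun s => ((⟨x s, hxX s⟩ : X), g s) := (hx.subtype_mk).prodMk hg
  exact hΦ.measurable.comp h2

section Continuity
variable (hw : IsDistanceGenerating X α w dw) (hX : Convex ℝ X) (hα : 0 < α)
  (hh : ConvexOn ℝ X h)
  (hproj : ∀ x ∈ X, ∀ (g : Vec n) (c : ℝ), 0 < c → ∃ u, IsGenProj X w dw h x g c u)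
  {γ : ℝ} (hγ : 0 < γ)
include hw hX hα hh hproj hγ

lemma continuous_genProj :
    Continuous (fun p : X × Vec n => genProj X w dw h p.1 p.2 γ) := by
  rw [continuous_iff_continuousAt]
  intro p
  have hsp : ∀ q : X × Vec n, IsGenProj X w dw h q.1 q.2 γ (genProj X w dw h q.1 q.2 γ) :=
    fun q => isGenProj_genProj (hproj _ q.1.2 _ _ hγ)
  have hdw : Continuous fun q : X × Vec n => dw q.1 :=
    (continuousOn_iff_continuous_domRestrict.1 hw.continuousOn).comp continuous_fst
  rw [ContinuousAt, tendsto_iff_norm_sub_tendsto_zero]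
  refine squeeze_zero (fun _ => norm_nonneg _)
    (fun q => (hsp q).norm_sub_le hw hX hα hh hγ (hsp p)) ?_
  have : Continuous fun q : X × Vec n =>
      γ / α * ‖q.2 - p.2‖ + 1 / α * ‖dw q.1 - dw p.1‖ :=
    ((continuous_snd.sub continuous_const).norm.const_mul _).add
      ((hdw.sub continuous_const).norm.const_mul _)
  simpa using this.tendsto p

/-- Convexity on `X` alone does not make `h` Borel, so measurability of `h` along the iterates has
to come from here. -/
lemma continuous_comp_genProj :
    Continuous (fun p : X × Vec n => h (genProj X w dw h p.1 p.2 γ)) := by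
  have hT := continuous_genProj hw hX hα hh hproj hγ
  have hsp : ∀ q : X × Vec n, IsGenProj X w dw h q.1 q.2 γ (genProj X w dw h q.1 q.2 γ) :=
    fun q => isGenProj_genProj (hproj _ q.1.2 _ _ hγ)
  obtain ⟨T, hTe⟩ : ∃ T : X × Vec n → Vec n, ∀ q, genProj X w dw h q.1 q.2 γ = T q :=
    ⟨_, fun _ => rfl⟩
  simp only [hTe] at hT hsp ⊢
  have hdw' := continuousOn_iff_continuous_domRestrict.1 hw.continuousOn
  have hdw : Continuous fun q : X × Vec n => dw q.1 := hdw'.comp continuous_fst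
  have hdT : Continuous fun q : X × Vec n => dw (T q) :=
    hdw'.comp (hT.subtype_mk fun q => (hsp q).1)
  refine continuous_iff_continuousAt.2 fun p => ?_
  have hdd : Continuous fun q : X × Vec n => dw (T q) - dw q.1 := hdT.sub hdw
  obtain ⟨D, hD⟩ : ∃ D : X × Vec n → Vec n, ∀ q, D q = dw (T q) - dw q.1 :=
    ⟨_, fun _ => rfl⟩
  simp only [← hD] at hdd
  have hB : Continuous fun q : X × Vec n =>
      (‖q.2 + (1 / γ) • D q‖ + ‖p.2 + (1 / γ) • D p‖) * ‖T q - T p‖ := by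
    fun_prop
  have hle : ∀ q : X × Vec n, ‖h (T q) - h (T p)‖ ≤
      (‖q.2 + (1 / γ) • D q‖ + ‖p.2 + (1 / γ) • D p‖) * ‖T q - T p‖ := fun q => by
    rw [Real.norm_eq_abs, hD, hD]
    exact (hsp q).abs_sub_le hw hX hh (hsp p)
  have hlim := hB.tendsto p
  rw [sub_self, norm_zero, mul_zero] at hlim
  exact tendsto_iff_norm_sub_tendsto_zero.2 (squeeze_zero (fun _ => norm_nonneg _) hle hlim)

variable {Ω : Type*} [MeasurableSpace Ω] {x g : Ω → Vec n}

lemma measurable_genProj (hx : Measurable x) (hg : Measurable g) (hxX : ∀ s, x s ∈ X) :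
    Measurable fun s => genProj X w dw h (x s) (g s) γ :=
  measurable_comp_of_continuous_subtype_prod
    (continuous_genProj hw hX hα hh hproj hγ) hx hg hxX

lemma measurable_comp_genProj (hx : Measurable x) (hg : Measurable g) (hxX : ∀ s, x s ∈ X) :
    Measurable fun s => h (genProj X w dw h (x s) (g s) γ) :=
  measurable_comp_of_continuous_subtype_prod
    (continuous_comp_genProj hw hX hα hh hproj hγ) hx hg hxX

end Continuity

end

-- The standard Gaussian measure: density, Stein's identity, moments.

section

section Gaussian
variable {E : Type*} [NormedAddCommGroup E] [InnerProductSpace ℝ E]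

variable (E) in
/-- The density of the standard Gaussian measure. -/
noncomputable def gaussDensity (v : E) : ℝ :=
  ((2 * Real.pi) ^ (Module.finrank ℝ E / 2 : ℝ))⁻¹ * Real.exp (-(1 / 2) * ‖v‖ ^ 2)

lemma gaussDensity_pos (v : E) : 0 < gaussDensity E v := by
  unfold gaussDensity; positivity

lemma continuous_gaussDensity : Continuous (gaussDensity E) := by
  unfold gaussDensity; fun_prop

lemma hasFDerivAt_gaussDensity (v : E) :
    HasFDerivAt (gaussDensity E) (-(gaussDensity E v) • innerSL ℝ v) v := by
  have h1 : HasFDerivAt (fun v : E => -(1 / 2) * ‖v‖ ^ 2) (-(innerSL ℝ v)) v := by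
    refine ((hasStrictFDerivAt_norm_sq v).hasFDerivAt.const_mul (-(1 / 2) : ℝ)).congr_fderiv ?_
    ext u; simp
  refine (h1.exp.const_mul ((2 * Real.pi) ^ (Module.finrank ℝ E / 2 : ℝ))⁻¹).congr_fderiv ?_
  ext u; simp [gaussDensity]; ring

variable [FiniteDimensional ℝ E] [MeasurableSpace E] [BorelSpace E]

lemma integrable_gaussDensity : Integrable (gaussDensity E) := by
  unfold gaussDensity
  refine Integrable.const_mul ?_ _
  have h := (GaussianFourier.integrable_cexp_neg_mul_sq_norm_add (V := E) (b := (1 / 2 : ℂ))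
    (by norm_num) 0 0).re
  refine h.congr (Filter.Eventually.of_forall fun v => ?_)
  have : (-(1 / 2 : ℂ) * ‖v‖ ^ 2 + 0 * (inner ℝ (0 : E) v : ℝ)) =
      ((-(1 / 2) * ‖v‖ ^ 2 : ℝ) : ℂ) := by push_cast; simp
  simp only [this]
  exact Complex.exp_ofReal_re _

/-- Both sides are finite measures with the same characteristic function. The density is needed in
order to integrate by parts against Lebesgue measure. -/
lemma stdGaussian_eq_withDensity :
    stdGaussian E = volume.withDensity fun v => ENNReal.ofReal (gaussDensity E v) := by
  have hfin : IsFiniteMeasure (volume.withDensity fun v => ENNReal.ofReal (gaussDensity E v)) :=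
    isFiniteMeasure_withDensity_ofReal integrable_gaussDensity.2
  apply Measure.ext_of_charFun
  ext t
  rw [charFun_stdGaussian, charFun_apply]
  have hm : Measurable fun v => (gaussDensity E v).toNNReal :=
    continuous_gaussDensity.measurable.real_toNNReal
  have e : (fun v => ENNReal.ofReal (gaussDensity E v)) =
      fun v => ((gaussDensity E v).toNNReal : ENNReal) := rfl
  rw [e, integral_withDensity_eq_integral_smul hm]
  have h := GaussianFourier.integral_cexp_neg_mul_sq_norm_add (V := E) (b := (1 / 2 : ℂ))
    (by norm_num) Complex.I t
  have h2 : ∀ v : E, (gaussDensity E v).toNNReal •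
      Complex.exp ((inner ℝ v t : ℝ) * Complex.I) =
      ((((2 * Real.pi) ^ (Module.finrank ℝ E / 2 : ℝ))⁻¹ : ℝ) : ℂ) *
      Complex.exp (-(1 / 2 : ℂ) * ‖v‖ ^ 2 + Complex.I * (inner ℝ t v : ℝ)) := fun v => by
    rw [NNReal.smul_def, Real.coe_toNNReal _ (gaussDensity_pos v).le, gaussDensity,
      Complex.exp_add, Complex.real_smul, real_inner_comm]
    push_cast
    rw [mul_comm Complex.I]
    ring
  simp_rw [h2]
  rw [integral_const_mul, h]
  have h3 : ((Real.pi : ℂ) / (1 / 2)) ^ (Module.finrank ℝ E / 2 : ℂ) =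
      (((2 * Real.pi) ^ (Module.finrank ℝ E / 2 : ℝ) : ℝ) : ℂ) := by
    rw [Complex.ofReal_cpow (by positivity)]
    push_cast
    congr 1
    ring
  rw [h3, ← mul_assoc, ← Complex.ofReal_mul, inv_mul_cancel₀ (by positivity)]
  simp
  ring_nf

lemma integrable_stdGaussian_iff {g : E → ℝ} :
    Integrable g (stdGaussian E) ↔ Integrable fun v => g v * gaussDensity E v := by
  rw [stdGaussian_eq_withDensity, integrable_withDensity_iff
    continuous_gaussDensity.measurable.ennreal_ofReal
    (Filter.Eventually.of_forall fun _ => ENNReal.ofReal_lt_top)]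
  simp only [ENNReal.toReal_ofReal (gaussDensity_pos _).le]

lemma integral_stdGaussian_eq (g : E → ℝ) :
    ∫ v, g v ∂(stdGaussian E) = ∫ v, g v * gaussDensity E v := by
  have hm : Measurable fun v => (gaussDensity E v).toNNReal :=
    continuous_gaussDensity.measurable.real_toNNReal
  have e : (fun v => ENNReal.ofReal (gaussDensity E v)) =
      fun v => ((gaussDensity E v).toNNReal : ENNReal) := rfl
  rw [stdGaussian_eq_withDensity, e, integral_withDensity_eq_integral_smul hm]
  refine integral_congr_ae (Filter.Eventually.of_forall fun v => ?_)
  simp only [NNReal.smul_def, Real.coe_toNNReal _ (gaussDensity_pos v).le, smul_eq_mul]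
  ring

/-- **Stein's identity** for the standard Gaussian measure. -/
lemma integral_mul_inner_stdGaussian {g : E → ℝ} {g' : E → E →L[ℝ] ℝ} (a : E)
    (hg : ∀ v, HasFDerivAt g (g' v) v) (h0 : Integrable g (stdGaussian E))
    (h1 : Integrable (fun v => g v * inner ℝ v a) (stdGaussian E))
    (h2 : Integrable (fun v => g' v a) (stdGaussian E)) :
    ∫ v, g v * inner ℝ v a ∂(stdGaussian E) = ∫ v, g' v a ∂(stdGaussian E) := by
  rw [integrable_stdGaussian_iff] at h0 h1 h2
  rw [integral_stdGaussian_eq, integral_stdGaussian_eq]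
  -- Integration by parts in direction `a`: differentiating the density brings down the factor `-⟨v,
  -- a⟩`.
  have := integral_bilinear_hasFDerivAt_right_eq_neg_left_of_integrable
    (B := ContinuousLinearMap.mul ℝ ℝ) (μ := (volume : Measure E)) (v := a) (f := g)
    (f' := g') (g := gaussDensity E) (g' := fun v => -(gaussDensity E v) • innerSL ℝ v)
    (by simpa using h2)
    (by refine h1.neg.congr (Filter.Eventually.of_forall fun v => ?_); simp; ring)
    (by simpa using h0) (fun v _ => hg v) (fun v _ => hasFDerivAt_gaussDensity v)
  simp only [ContinuousLinearMap.mul_apply', smul_apply,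
    innerSL_apply_apply, smul_eq_mul] at this
  rw [← neg_inj, ← this, ← integral_neg]
  congr 1; ext v; ring

lemma integrable_norm_pow_stdGaussian (k : ℕ) :
    Integrable (fun v : E => ‖v‖ ^ k) (stdGaussian E) :=
  MemLp.integrable_norm_pow' (IsGaussian.memLp_id (stdGaussian E) k (by simp))

lemma integrable_sq_norm_pow_mul_inner_sq (k : ℕ) (a : E) :
    Integrable (fun v : E => (‖v‖ ^ 2) ^ k * inner ℝ v a ^ 2) (stdGaussian E) := by
  refine ((integrable_norm_pow_stdGaussian (E := E) (2 * k + 2)).const_mul (‖a‖ ^ 2)).mono'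
    (by fun_prop) (Filter.Eventually.of_forall fun v => ?_)
  rw [Real.norm_of_nonneg (by positivity)]
  have h1 : inner ℝ v a ^ 2 ≤ (‖v‖ * ‖a‖) ^ 2 := sq_le_sq' (by
    have := abs_real_inner_le_norm v a
    linarith [neg_abs_le (inner ℝ v a)]) (real_inner_le_norm v a)
  calc (‖v‖ ^ 2) ^ k * inner ℝ v a ^ 2 ≤ (‖v‖ ^ 2) ^ k * (‖v‖ * ‖a‖) ^ 2 := by gcongr
    _ = _ := by ring

/-- Stein's identity for `v ↦ ‖v‖^{2k} ⟨v, a⟩`. For `k = 0` the truncated exponent `k - 1` is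
harmless, its term having the factor `2 * k = 0`. -/
lemma integral_sq_norm_pow_mul_inner_sq (k : ℕ) (a : E) :
    ∫ v, (‖v‖ ^ 2) ^ k * inner ℝ v a ^ 2 ∂(stdGaussian E) =
      ‖a‖ ^ 2 * ∫ v, (‖v‖ ^ 2) ^ k ∂(stdGaussian E) +
      2 * k * ∫ v, (‖v‖ ^ 2) ^ (k - 1) * inner ℝ v a ^ 2 ∂(stdGaussian E) := by
  have hk : Integrable (fun v : E => (‖v‖ ^ 2) ^ k) (stdGaussian E) := by
    simpa only [← pow_mul] using integrable_norm_pow_stdGaussian (E := E) (2 * k)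
  have hd : ∀ v : E, HasFDerivAt (fun v : E => (‖v‖ ^ 2) ^ k * inner ℝ v a)
      ((‖v‖ ^ 2) ^ k • innerSL ℝ a +
        inner ℝ v a • ((k * (‖v‖ ^ 2) ^ (k - 1)) • (2 • innerSL ℝ v))) v := fun v => by
    have h1 := ((hasStrictFDerivAt_norm_sq v).hasFDerivAt.pow k)
    have h2 : HasFDerivAt (fun v : E => inner ℝ v a) (innerSL ℝ a) v := by
      refine ((innerSL ℝ a).hasFDerivAt (x := v)).congr_of_eventuallyEq ?_
      exact Filter.Eventually.of_forall fun u => real_inner_comm _ _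
    refine (h1.mul h2).congr_fderiv ?_
    ext u; simp
  have e : ∀ v : E, ((‖v‖ ^ 2) ^ k • innerSL ℝ a +
        inner ℝ v a • ((k * (‖v‖ ^ 2) ^ (k - 1)) • (2 • innerSL ℝ v))) a =
      ‖a‖ ^ 2 * (‖v‖ ^ 2) ^ k + 2 * k * ((‖v‖ ^ 2) ^ (k - 1) * inner ℝ v a ^ 2) := fun v => by
    simp; ring
  have hi1 := hk.const_mul (‖a‖ ^ 2)
  have hi2 := (integrable_sq_norm_pow_mul_inner_sq (k - 1) a).const_mul (2 * k : ℝ)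
  have := integral_mul_inner_stdGaussian a hd
    (by
      refine ((integrable_norm_pow_stdGaussian (E := E) (2 * k + 1)).const_mul ‖a‖).mono'
        (by fun_prop) (Filter.Eventually.of_forall fun v => ?_)
      rw [norm_mul, Real.norm_of_nonneg (by positivity)]
      calc (‖v‖ ^ 2) ^ k * ‖inner ℝ v a‖ ≤ (‖v‖ ^ 2) ^ k * (‖v‖ * ‖a‖) := by
            gcongr; exact norm_inner_le_norm v a
        _ = _ := by ring)
    ((integrable_sq_norm_pow_mul_inner_sq k a).congr
      (Filter.Eventually.of_forall fun v => by simp only; ring))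
    (by simp_rw [e]; exact hi1.add hi2)
  simp_rw [e] at this
  rw [integral_add hi1 hi2, integral_const_mul, integral_const_mul] at this
  rw [← this]
  congr 1; ext v; ring

/-- Summing the preceding identity over an orthonormal basis and using Parseval gives a recursion
for all even moments. -/
lemma integral_sq_norm_pow_succ (k : ℕ) :
    ∫ v, (‖v‖ ^ 2) ^ (k + 1) ∂(stdGaussian E) =
      (Module.finrank ℝ E + 2 * k) * ∫ v, (‖v‖ ^ 2) ^ k ∂(stdGaussian E) := by
  have hs : ∀ (j : ℕ) (v : E), (‖v‖ ^ 2) ^ (j + 1) =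
      ∑ i, (‖v‖ ^ 2) ^ j * inner ℝ v (stdOrthonormalBasis ℝ E i) ^ 2 := fun j v => by
    rw [← Finset.mul_sum, (stdOrthonormalBasis ℝ E).sum_sq_inner_left, pow_succ]
  simp_rw [hs k]
  rw [integral_finsetSum _ fun i _ => integrable_sq_norm_pow_mul_inner_sq k _]
  simp_rw [integral_sq_norm_pow_mul_inner_sq k]
  rw [Finset.sum_add_distrib, ← Finset.mul_sum,
    ← integral_finsetSum _ fun i _ => integrable_sq_norm_pow_mul_inner_sq (k - 1) _]
  rcases k with _ | k
  · simp
  · simp only [Nat.add_sub_cancel, ← hs k]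
    simp
    ring

lemma integral_sq_norm_stdGaussian :
    ∫ v : E, ‖v‖ ^ 2 ∂(stdGaussian E) = Module.finrank ℝ E := by
  simpa using integral_sq_norm_pow_succ (E := E) 0

lemma integral_inner_sq_stdGaussian (a : E) :
    ∫ v : E, inner ℝ v a ^ 2 ∂(stdGaussian E) = ‖a‖ ^ 2 := by
  simpa using integral_sq_norm_pow_mul_inner_sq 0 a

lemma integral_sq_norm_mul_inner_sq_stdGaussian (a : E) :
    ∫ v : E, ‖v‖ ^ 2 * inner ℝ v a ^ 2 ∂(stdGaussian E) =
      (Module.finrank ℝ E + 2) * ‖a‖ ^ 2 := by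
  have := integral_sq_norm_pow_mul_inner_sq 1 a
  simp only [pow_one, integral_sq_norm_stdGaussian, Nat.cast_one, Nat.sub_self, pow_zero,
    one_mul, integral_inner_sq_stdGaussian] at this
  rw [this]; ring

lemma integral_norm_pow_six_stdGaussian :
    ∫ v : E, ‖v‖ ^ 6 ∂(stdGaussian E) =
      (Module.finrank ℝ E : ℝ) * (Module.finrank ℝ E + 2) * (Module.finrank ℝ E + 4) := by
  have h1 := integral_sq_norm_pow_succ (E := E) 2
  have h2 := integral_sq_norm_pow_succ (E := E) 1
  simp only [pow_one, integral_sq_norm_stdGaussian, Nat.reduceAdd] at h1 h2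
  rw [h2] at h1
  simp only [← pow_mul, Nat.reduceMul] at h1
  rw [h1]; push_cast; ring

end Gaussian

end

-- Gaussian smoothing of a `C^{1,1}` function.

section

variable {n : ℕ}

section Smoothing

/-- The Gaussian smoothing `x ↦ 𝔼[f (x + μ v)]`. -/
noncomputable def smoothing (μ : ℝ) (f : Vec n → ℝ) (x : Vec n) : ℝ :=
  ∫ v, f (x + μ • v) ∂(stdGaussian (Vec n))

/-- The smoothed gradient `x ↦ 𝔼[∇f (x + μ v)]`. -/
noncomputable def smoothedGradient (μ : ℝ) (f : Vec n → ℝ) (x : Vec n) : Vec n :=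
  ∫ v, ∇ f (x + μ • v) ∂(stdGaussian (Vec n))

variable {L μ : ℝ} {f : Vec n → ℝ}

lemma IsC11.abs_shift_sub_le (hf : IsC11 L f) (x v : Vec n) :
    |f (x + μ • v) - f x - μ * inner ℝ (∇ f x) v| ≤ L / 2 * (μ ^ 2 * ‖v‖ ^ 2) := by
  have := hf.abs_sub_le x (x + μ • v)
  rwa [add_sub_cancel_left, inner_smul_right, norm_smul, mul_pow, Real.norm_eq_abs, sq_abs] at this

lemma IsC11.norm_gradient_shift_sub_le (hf : IsC11 L f) (x v : Vec n) :
    ‖∇ f (x + μ • v) - ∇ f x‖ ≤ L * |μ| * ‖v‖ := by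
  have := hf.2 x (x + μ • v)
  rwa [add_sub_cancel_left, norm_smul, Real.norm_eq_abs, ← mul_assoc] at this

lemma IsC11.continuous (hf : IsC11 L f) : Continuous f := hf.1.continuous

lemma integrable_norm_stdGaussian : Integrable (fun v : Vec n => ‖v‖) (stdGaussian (Vec n)) := by
  simpa using integrable_norm_pow_stdGaussian (E := Vec n) 1

lemma integrable_id_stdGaussian : Integrable (fun v : Vec n => v) (stdGaussian (Vec n)) :=
  integrable_norm_stdGaussian.mono' (by fun_prop) (Filter.Eventually.of_forall fun _ => le_rfl)

lemma IsC11.integrable_shift (hf : IsC11 L f) (x : Vec n) :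
    Integrable (fun v => f (x + μ • v)) (stdGaussian (Vec n)) := by
  have hc := hf.continuous
  have hi : Integrable (fun v => |f x| + |μ| * (‖∇ f x‖ * ‖v‖) + L / 2 * (μ ^ 2 * ‖v‖ ^ 2))
      (stdGaussian (Vec n)) :=
    ((integrable_const _).add ((integrable_norm_stdGaussian.const_mul _).const_mul _)).add
      (((integrable_norm_pow_stdGaussian 2).const_mul _).const_mul _)
  refine hi.mono' (by fun_prop) (Filter.Eventually.of_forall fun v => ?_)
  have h1 := hf.abs_shift_sub_le (μ := μ) x v
  have h2 : |μ * inner ℝ (∇ f x) v| ≤ |μ| * (‖∇ f x‖ * ‖v‖) := by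
    rw [abs_mul]; gcongr; exact abs_real_inner_le_norm _ _
  rw [Real.norm_eq_abs]
  have h3 : f (x + μ • v) = f x + μ * inner ℝ (∇ f x) v +
    (f (x + μ • v) - f x - μ * inner ℝ (∇ f x) v) := by ring
  rw [h3]
  refine (abs_add_three _ _ _).trans ?_
  linarith

lemma IsC11.integrable_gradient_shift (hf : IsC11 L f) (x : Vec n) :
    Integrable (fun v => ∇ f (x + μ • v)) (stdGaussian (Vec n)) := by
  have hc := hf.continuous_gradient
  have hi : Integrable (fun v => ‖∇ f x‖ + L * |μ| * ‖v‖) (stdGaussian (Vec n)) :=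
    (integrable_const _).add (integrable_norm_stdGaussian.const_mul _)
  refine hi.mono' (Continuous.aestronglyMeasurable (by fun_prop))
    (Filter.Eventually.of_forall fun v => ?_)
  have h1 := hf.norm_gradient_shift_sub_le (μ := μ) x v
  linarith [norm_le_norm_add_norm_sub' (∇ f (x + μ • v)) (∇ f x)]

lemma integral_inner_const_left {Ω : Type*} [MeasurableSpace Ω] {P : Measure Ω} {g : Ω → Vec n}
    (hg : Integrable g P) (a : Vec n) :
    ∫ s, inner ℝ (g s) a ∂P = inner ℝ (∫ s, g s ∂P) a := by
  simp_rw [real_inner_comm a]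
  rw [integral_inner hg]

/-- Averaging the quadratic expansions of `f` at the points `x + μv` gives one for the smoothing
with the same constant, so no differentiation under the integral is needed. -/
lemma IsC11.smoothing (hf : IsC11 L f) :
    IsC11 L (smoothing μ f) ∧ ∇ (RSPGF.smoothing μ f) = smoothedGradient μ f := by
  apply isC11_of_abs_sub_le
  · intro x y
    have hy := hf.integrable_shift (μ := μ) y
    have hx := hf.integrable_shift (μ := μ) x
    have hg := hf.integrable_gradient_shift (μ := μ) x
    have hgi : Integrable (fun v => inner ℝ (∇ f (x + μ • v)) (y - x)) (stdGaussian (Vec n)) :=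
      hg.inner_const (y - x)
    have hyx : Integrable (fun v => f (y + μ • v) - f (x + μ • v)) (stdGaussian (Vec n)) :=
      hy.sub hx
    rw [RSPGF.smoothing, RSPGF.smoothing, smoothedGradient, ← integral_inner_const_left hg,
      ← integral_sub hy hx, ← integral_sub hyx hgi]
    have := norm_integral_le_of_norm_le_const (μ := stdGaussian (Vec n))
      (f := fun v => f (y + μ • v) - f (x + μ • v) - inner ℝ (∇ f (x + μ • v)) (y - x))
      (C := L / 2 * ‖y - x‖ ^ 2) (Filter.Eventually.of_forall fun v => by
        have := hf.abs_sub_le (x + μ • v) (y + μ • v)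
        rwa [add_sub_add_right_eq_sub] at this)
    simpa using this
  · intro x y
    have hx := hf.integrable_gradient_shift (μ := μ) x
    have hy := hf.integrable_gradient_shift (μ := μ) y
    rw [smoothedGradient, smoothedGradient, ← integral_sub hy hx]
    have := norm_integral_le_of_norm_le_const (μ := stdGaussian (Vec n))
      (f := fun v => ∇ f (y + μ • v) - ∇ f (x + μ • v))
      (C := L * ‖y - x‖) (Filter.Eventually.of_forall fun v => by
        have := hf.2 (x + μ • v) (y + μ • v)
        rwa [add_sub_add_right_eq_sub] at this)
    simpa using this

/-- The linear term of the expansion has mean zero, and the quadratic remainder averages to `𝔼‖v‖² =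
n`. -/
lemma IsC11.abs_smoothing_sub_le (hf : IsC11 L f) (x : Vec n) :
    |RSPGF.smoothing μ f x - f x| ≤ L / 2 * (μ ^ 2 * n) := by
  have hi : Integrable (fun v => μ * inner ℝ (∇ f x) v) (stdGaussian (Vec n)) :=
    (integrable_id_stdGaussian.const_inner (∇ f x)).const_mul μ
  have h0 : ∫ v, μ * inner ℝ (∇ f x) v ∂(stdGaussian (Vec n)) = 0 := by
    rw [integral_const_mul, integral_inner integrable_id_stdGaussian, integral_id_stdGaussian,
      inner_zero_right, mul_zero]
  have e : RSPGF.smoothing μ f x - f x = ∫ v, (f (x + μ • v) - f x - μ * inner ℝ (∇ f x) v)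
      ∂(stdGaussian (Vec n)) := by
    have h1 : Integrable (fun v => f (x + μ • v) - f x) (stdGaussian (Vec n)) :=
      (hf.integrable_shift x).sub (integrable_const _)
    rw [integral_sub h1 hi, h0,
      integral_sub (hf.integrable_shift x) (integrable_const _)]
    simp [RSPGF.smoothing]
  rw [e, ← Real.norm_eq_abs]
  refine (norm_integral_le_of_norm_le
    (((integrable_norm_pow_stdGaussian 2).const_mul (μ ^ 2)).const_mul (L / 2))
    (Filter.Eventually.of_forall fun v => hf.abs_shift_sub_le x v)).trans_eq ?_
  rw [integral_const_mul, integral_const_mul, integral_sq_norm_stdGaussian]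
  simp

lemma IsC11.norm_smoothedGradient_sub_sq_le (hf : IsC11 L f) (x : Vec n) :
    ‖smoothedGradient μ f x - ∇ f x‖ ^ 2 ≤ L ^ 2 * μ ^ 2 * n := by
  have e : smoothedGradient μ f x - ∇ f x =
      ∫ v, (∇ f (x + μ • v) - ∇ f x) ∂(stdGaussian (Vec n)) := by
    rw [integral_sub (hf.integrable_gradient_shift x) (integrable_const _)]
    simp [smoothedGradient]
  have h1 : ‖smoothedGradient μ f x - ∇ f x‖ ≤
      L * |μ| * ∫ v : Vec n, ‖v‖ ∂(stdGaussian (Vec n)) := by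
    rw [e, ← integral_const_mul]
    exact norm_integral_le_of_norm_le (integrable_norm_stdGaussian.const_mul _)
      (Filter.Eventually.of_forall fun v => hf.norm_gradient_shift_sub_le x v)
  -- Nonnegativity of the variance of `‖v‖`.
  have h2 : (∫ v : Vec n, ‖v‖ ∂(stdGaussian (Vec n))) ^ 2 ≤ n := by
    have hm : MemLp (fun v : Vec n => ‖v‖) 2 (stdGaussian (Vec n)) :=
      (IsGaussian.memLp_two_id).norm
    have h3 := variance_nonneg (fun v : Vec n => ‖v‖) (stdGaussian (Vec n))
    rw [variance_eq_sub hm] at h3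
    have h4 : ∫ v : Vec n, ((fun v : Vec n => ‖v‖) ^ 2) v ∂(stdGaussian (Vec n)) = n := by
      simpa using integral_sq_norm_stdGaussian (E := Vec n)
    rw [h4] at h3
    linarith
  calc ‖smoothedGradient μ f x - ∇ f x‖ ^ 2
      ≤ (L * |μ| * ∫ v : Vec n, ‖v‖ ∂(stdGaussian (Vec n))) ^ 2 := by gcongr
    _ = L ^ 2 * μ ^ 2 * (∫ v : Vec n, ‖v‖ ∂(stdGaussian (Vec n))) ^ 2 := by
        rw [mul_pow, mul_pow, sq_abs]
    _ ≤ _ := by gcongr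

/-- Averages the gradient inequality of `f` over the shifts; this one consequence of convexity is
all that `convex_step` asks of the smoothing. -/
lemma IsC11.smoothing_add_inner_le (hf : IsC11 L f) (hc : ConvexOn ℝ Set.univ f) (x y : Vec n) :
    RSPGF.smoothing μ f x + inner ℝ (smoothedGradient μ f x) (y - x) ≤ RSPGF.smoothing μ f y := by
  have hg := hf.integrable_gradient_shift (μ := μ) x
  rw [RSPGF.smoothing, RSPGF.smoothing, smoothedGradient, ← integral_inner_const_left hg,
    ← integral_add (hf.integrable_shift x) (hg.inner_const (y - x))]
  refine integral_mono ((hf.integrable_shift x).add (hg.inner_const (y - x)))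
    (hf.integrable_shift y) fun v => ?_
  have := add_inner_le_of_convexOn hc (hf.hasGradientAt (x + μ • v)) (y + μ • v)
  rwa [add_sub_add_right_eq_sub] at this

lemma IsC11.integrable_quotient_smul (hf : IsC11 L f) (x : Vec n) :
    Integrable (fun v => ((f (x + μ • v) - f x) / μ) • v) (stdGaussian (Vec n)) := by
  have hc := hf.continuous
  have hi : Integrable (fun v => (|μ| * (‖∇ f x‖ * ‖v‖ ^ 2) + L / 2 * (μ ^ 2 * ‖v‖ ^ 3)) / |μ|)
      (stdGaussian (Vec n)) :=
    (((((integrable_norm_pow_stdGaussian 2)).const_mul _).const_mul _).add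
      (((integrable_norm_pow_stdGaussian 3).const_mul _).const_mul _)).div_const _
  refine hi.mono' (by fun_prop) (Filter.Eventually.of_forall fun v => ?_)
  have h1 := hf.abs_shift_sub_le (μ := μ) x v
  have h2 : |μ * inner ℝ (∇ f x) v| ≤ |μ| * (‖∇ f x‖ * ‖v‖) := by
    rw [abs_mul]; gcongr; exact abs_real_inner_le_norm _ _
  have h3 : |f (x + μ • v) - f x| ≤ |μ| * (‖∇ f x‖ * ‖v‖) + L / 2 * (μ ^ 2 * ‖v‖ ^ 2) := by
    rw [show f (x + μ • v) - f x = μ * inner ℝ (∇ f x) v +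
      (f (x + μ • v) - f x - μ * inner ℝ (∇ f x) v) by ring]
    exact (abs_add_le _ _).trans (add_le_add h2 h1)
  rw [norm_smul, norm_div, Real.norm_eq_abs, Real.norm_eq_abs, div_mul_eq_mul_div]
  refine div_le_div_of_nonneg_right ?_ (abs_nonneg _)
  refine (mul_le_mul_of_nonneg_right h3 (norm_nonneg v)).trans_eq ?_
  ring

/-- Stein's identity applied to the difference quotient as a function of `v`, tested against each
direction `a`. The `1/μ` cancels the `μ` from the chain rule. -/
lemma IsC11.integral_quotient_smul (hf : IsC11 L f) (hμ : μ ≠ 0) (x : Vec n) :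
    ∫ v, ((f (x + μ • v) - f x) / μ) • v ∂(stdGaussian (Vec n)) = smoothedGradient μ f x := by
  refine ext_inner_right ℝ fun a => ?_
  have hq := hf.integrable_quotient_smul (μ := μ) x
  have hg := hf.integrable_gradient_shift (μ := μ) x
  rw [smoothedGradient, ← integral_inner_const_left hq, ← integral_inner_const_left hg]
  have hd : ∀ v, HasFDerivAt (fun v => (f (x + μ • v) - f x) / μ)
      (InnerProductSpace.toDual ℝ (Vec n) (∇ f (x + μ • v))) v := fun v => by
    have h1 : HasFDerivAt (fun v : Vec n => x + μ • v) (μ • ContinuousLinearMap.id ℝ (Vec n)) v :=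
      ((hasFDerivAt_id v).const_smul μ).const_add x
    have h2 := (((hf.hasGradientAt (x + μ • v)).hasFDerivAt.comp v h1).sub_const (f x)).const_mul μ⁻¹
    have h3 : (fun v => (f (x + μ • v) - f x) / μ) =
        fun v => μ⁻¹ * ((f ∘ fun v : Vec n => x + μ • v) v - f x) := by
      ext v; simp [div_eq_inv_mul]
    rw [h3]
    refine h2.congr_fderiv ?_
    ext u
    simp [hμ]
  have h1 := integral_mul_inner_stdGaussian a hd
    (((hf.integrable_shift x).sub (integrable_const _)).div_const _)
    ((hq.inner_const a).congr (Filter.Eventually.of_forall fun v => by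
      simp only [inner_smul_left, conj_trivial]))
    ((hg.inner_const a).congr (Filter.Eventually.of_forall fun v => by simp))
  simp only [inner_smul_left, conj_trivial, InnerProductSpace.toDual_apply_apply] at h1 ⊢
  exact h1

end Smoothing

end

-- The one-sample estimator at a fixed point.

section

variable {n : ℕ} {Ξ : Type*} {X : Set (Vec n)} {f : Vec n → ℝ}
  {F : Vec n → Ξ → ℝ} {L σ μ M : ℝ}

/-- Write the increment as `μ⟨∇F, v⟩ + r` with `|r| ≤ Lμ²‖v‖²/2` and use `(a + b)² ≤ 2a² + 2b²`. -/
lemma norm_gradEst_sq_le {z : Ξ} (hz : IsC11 L (fun x => F x z)) (hμ : μ ≠ 0) (x v : Vec n) :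
    ‖gradEst F μ x z v‖ ^ 2 ≤ 2 * (‖v‖ ^ 2 * inner ℝ v (∇ (fun y => F y z) x) ^ 2) +
      μ ^ 2 * L ^ 2 / 2 * ‖v‖ ^ 6 := by
  have h1 := hz.abs_shift_sub_le (μ := μ) x v
  rw [gradEst, norm_smul, mul_pow, Real.norm_eq_abs, sq_abs, div_pow]
  set p := inner ℝ (∇ (fun y => F y z) x) v with hp
  have hp' : inner ℝ v (∇ (fun y => F y z) x) = p := real_inner_comm _ _
  rw [hp']
  set r := F (x + μ • v) z - F x z - μ * p with hr
  have h2 : F (x + μ • v) z - F x z = μ * p + r := by rw [hr]; ring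
  have h3 : r ^ 2 ≤ (L / 2 * (μ ^ 2 * ‖v‖ ^ 2)) ^ 2 := sq_le_sq' (abs_le.1 h1).1 (abs_le.1 h1).2
  rw [h2]
  have hμ2 : 0 < μ ^ 2 := by positivity
  have h4 : (μ * p + r) ^ 2 / μ ^ 2 ≤ 2 * p ^ 2 + μ ^ 2 * L ^ 2 / 2 * ‖v‖ ^ 4 := by
    rw [div_le_iff₀ hμ2]
    nlinarith [sq_nonneg (μ * p - r)]
  calc (μ * p + r) ^ 2 / μ ^ 2 * ‖v‖ ^ 2
      ≤ (2 * p ^ 2 + μ ^ 2 * L ^ 2 / 2 * ‖v‖ ^ 4) * ‖v‖ ^ 2 := by gcongr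
    _ = _ := by ring

variable [MeasurableSpace Ξ] {ν : Measure Ξ}

/-- Each coordinate of the gradient is almost everywhere a limit of difference quotients of `F`,
which are measurable in the noise. -/
lemma aestronglyMeasurable_gradient (hF : Measurable (Function.uncurry F))
    (hs : ∀ᵐ z ∂ν, IsC11 L (fun x => F x z)) (x : Vec n) :
    AEStronglyMeasurable (fun z => ∇ (fun y => F y z) x) ν := by
  have hFx : ∀ y, Measurable fun z => F y z := fun y => hF.of_uncurry_left
  have hcoord : ∀ e : Vec n, AEStronglyMeasurable (fun z => inner ℝ e (∇ (fun y => F y z) x)) ν := by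
    intro e
    refine aestronglyMeasurable_of_tendsto_ae Filter.atTop
      (f := fun (k : ℕ) z => (F (x + (1 / ((k : ℝ) + 1)) • e) z - F x z) / (1 / ((k : ℝ) + 1)))
      (fun k => (((hFx _).sub (hFx _)).div_const _).aestronglyMeasurable) ?_
    filter_upwards [hs] with z hz
    have h1 : HasDerivAt (fun t : ℝ => F (x + t • e) z) (inner ℝ e (∇ (fun y => F y z) x)) 0 := by
      have h2 := hasDerivWithinAt_comp_segment (t := 0) convex_univ (Set.mem_univ x)
        (Set.mem_univ (x + e)) (φ := fun y => F y z)
        (hz.hasGradientAt (x + (0 : ℝ) • (x + e - x))).hasFDerivAt.hasFDerivWithinAt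
      have h3 : HasDerivAt (fun t : ℝ => x + t • e) e 0 := by
        simpa using ((hasDerivAt_id (0 : ℝ)).smul_const e).const_add x
      have h4 : HasFDerivAt (fun y => F y z) _ (x + (0 : ℝ) • e) :=
        (hz.hasGradientAt _).hasFDerivAt
      have h5 := h4.comp_hasDerivAt (0 : ℝ) h3
      refine h5.congr_deriv ?_
      rw [zero_smul, add_zero, InnerProductSpace.toDual_apply_apply, real_inner_comm]
    have h2 := h1.tendsto_slope_zero_right.comp
      (tendsto_nhdsWithin_iff.2 ⟨tendsto_one_div_add_atTop_nhds_zero_nat (𝕜 := ℝ),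
        Filter.Eventually.of_forall fun k => by
          simp only [Set.mem_Ioi]; positivity⟩)
    refine h2.congr fun k => ?_
    simp [div_eq_inv_mul]
  have : (fun z => ∇ (fun y => F y z) x) = fun z =>
      ∑ i, inner ℝ (EuclideanSpace.basisFun (Fin n) ℝ i) (∇ (fun y => F y z) x) •
        EuclideanSpace.basisFun (Fin n) ℝ i := by
    ext1 z
    exact ((EuclideanSpace.basisFun (Fin n) ℝ).sum_repr' _).symm
  rw [this]
  exact Finset.aestronglyMeasurable_fun_sum _ fun i _ => (hcoord _).smul_const _

section
variable [IsProbabilityMeasure ν] (ho : IsOracle X f F L σ ν)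
  (hF : Measurable (Function.uncurry F))
include ho hF

/-- The oracle controls stochastic gradients only on `X`; the Lipschitz bound carries integrability
from one point of `X` to all of `ℝⁿ`. -/
lemma IsOracle.integrable_gradient {x₁ : Vec n} (hx₁ : x₁ ∈ X) (x : Vec n) :
    Integrable (fun z => ∇ (fun y => F y z) x) ν := by
  have hi : Integrable (fun z => ‖∇ (fun y => F y z) x₁‖ + L * ‖x - x₁‖) ν :=
    (ho.integrable_grad x₁ hx₁).norm.add (integrable_const _)
  refine hi.mono' (aestronglyMeasurable_gradient hF ho.smooth x) ?_
  filter_upwards [ho.smooth] with z hz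
  linarith [hz.2 x₁ x, norm_le_norm_add_norm_sub' (∇ (fun y => F y z) x) (∇ (fun y => F y z) x₁)]

/-- Differentiability of `f` is derived, not assumed: averaging the expansions of `F(·, ξ)` gives
one for `f`, whose linear part is the mean stochastic gradient. -/
lemma IsOracle.isC11 {x₁ : Vec n} (hx₁ : x₁ ∈ X) : IsC11 L f := by
  have hg := fun x => ho.integrable_gradient hF hx₁ x
  refine (isC11_of_abs_sub_le (p := fun x => ∫ z, ∇ (fun y => F y z) x ∂ν) ?_ ?_).1
  · intro x y
    have h1 : Integrable (fun z => F y z - F x z) ν :=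
      (ho.integrable_value y).sub (ho.integrable_value x)
    rw [← ho.mean_value y, ← ho.mean_value x, ← integral_inner_const_left (hg x),
      ← integral_sub (ho.integrable_value y) (ho.integrable_value x),
      ← integral_sub h1 ((hg x).inner_const (y - x))]
    have := norm_integral_le_of_norm_le_const (μ := ν)
      (f := fun z => F y z - F x z - inner ℝ (∇ (fun y => F y z) x) (y - x))
      (C := L / 2 * ‖y - x‖ ^ 2) (by
        filter_upwards [ho.smooth] with z hz using hz.abs_sub_le x y)
    simpa using this
  · intro x y
    rw [← integral_sub (hg y) (hg x)]
    have := norm_integral_le_of_norm_le_const (μ := ν)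
      (f := fun z => ∇ (fun y => F y z) y - ∇ (fun y => F y z) x)
      (C := L * ‖y - x‖) (by
        filter_upwards [ho.smooth] with z hz using hz.2 x y)
    simpa using this

omit hF in
-- The bias–variance decomposition: the second moment is the variance plus `‖∇f(x)‖²`.
lemma IsOracle.integrable_norm_gradient_sq {x : Vec n} (hx : x ∈ X) (hM : ‖∇ f x‖ ≤ M) :
    Integrable (fun z => ‖∇ (fun y => F y z) x‖ ^ 2) ν ∧
      ∫ z, ‖∇ (fun y => F y z) x‖ ^ 2 ∂ν ≤ M ^ 2 + σ ^ 2 := by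
  have hi := ho.integrable_grad x hx
  have hi2 : Integrable (fun z => inner ℝ (∇ (fun y => F y z) x) (∇ f x)) ν := hi.inner_const _
  have hi3 : Integrable (fun z => ‖∇ (fun y => F y z) x - ∇ f x‖ ^ 2 +
      2 * inner ℝ (∇ (fun y => F y z) x) (∇ f x)) ν :=
    (ho.integrable_variance x hx).add (hi2.const_mul 2)
  have e : ∀ z, ‖∇ (fun y => F y z) x‖ ^ 2 = ‖∇ (fun y => F y z) x - ∇ f x‖ ^ 2 +
      2 * inner ℝ (∇ (fun y => F y z) x) (∇ f x) - ‖∇ f x‖ ^ 2 := fun z => by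
    rw [norm_sub_sq_real]; ring
  simp_rw [e]
  refine ⟨hi3.sub (integrable_const _), ?_⟩
  rw [integral_sub hi3 (integrable_const _),
    integral_add (ho.integrable_variance x hx) (hi2.const_mul 2), integral_const_mul,
    integral_inner_const_left hi, ho.mean_grad x hx, real_inner_self_eq_norm_sq]
  have h1 := ho.variance_le x hx
  have h2 : ‖∇ f x‖ ^ 2 ≤ M ^ 2 := by gcongr
  simp
  linarith

omit ho in
lemma measurable_gradEst {Ω : Type*} [MeasurableSpace Ω] {u : Ω → Vec n} {ζ : Ω → Ξ}
    {ϑ : Ω → Vec n} (hu : Measurable u) (hζ : Measurable ζ) (hϑ : Measurable ϑ) :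
    Measurable fun s => gradEst F μ (u s) (ζ s) (ϑ s) := by
  have h1 : Measurable fun s => F (u s + μ • ϑ s) (ζ s) :=
    hF.comp ((hu.add (hϑ.const_smul μ)).prodMk hζ)
  have h2 : Measurable fun s => F (u s) (ζ s) := hF.comp (hu.prodMk hζ)
  exact ((h1.sub h2).div_const μ).smul hϑ

end

section
variable [IsProbabilityMeasure ν] (ho : IsOracle X f F L σ ν)
  (hF : Measurable (Function.uncurry F)) (hμ : μ ≠ 0) {x : Vec n} (hx : x ∈ X)
  (hM : ‖∇ f x‖ ≤ M)
include ho hF hμ hx hM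

/-- The pointwise bound is integrated over the direction, where `𝔼‖v‖²⟨v, a⟩² = (n + 2)‖a‖²` and
`𝔼‖v‖⁶ = n(n + 2)(n + 4)`, and then over the noise. Integrability on the product follows from that
of the sections and of their integrals. -/
lemma IsOracle.integrable_norm_gradEst_sq :
    Integrable (fun p : Ξ × Vec n => ‖gradEst F μ x p.1 p.2‖ ^ 2) (ν.prod (stdGaussian (Vec n))) ∧
      ∫ p, ‖gradEst F μ x p.1 p.2‖ ^ 2 ∂(ν.prod (stdGaussian (Vec n))) ≤
        sigmaTildeSq n M σ μ L := by
  have hm : Measurable fun p : Ξ × Vec n => ‖gradEst F μ x p.1 p.2‖ ^ 2 :=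
    ((measurable_gradEst hF measurable_const measurable_fst measurable_snd).norm).pow_const 2
  have hbi : ∀ a : Vec n, Integrable (fun v : Vec n => 2 * (‖v‖ ^ 2 * inner ℝ v a ^ 2) +
      μ ^ 2 * L ^ 2 / 2 * ‖v‖ ^ 6) (stdGaussian (Vec n)) := fun a =>
    ((by simpa using integrable_sq_norm_pow_mul_inner_sq (E := Vec n) 1 a :
      Integrable (fun v : Vec n => ‖v‖ ^ 2 * inner ℝ v a ^ 2) _).const_mul 2).add
      ((integrable_norm_pow_stdGaussian 6).const_mul _)
  have hbe : ∀ a : Vec n, ∫ v : Vec n, (2 * (‖v‖ ^ 2 * inner ℝ v a ^ 2) +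
      μ ^ 2 * L ^ 2 / 2 * ‖v‖ ^ 6) ∂(stdGaussian (Vec n)) =
      2 * (n + 2) * ‖a‖ ^ 2 + μ ^ 2 * L ^ 2 / 2 * (n * (n + 2) * (n + 4)) := fun a => by
    rw [integral_add, integral_const_mul, integral_const_mul,
      integral_sq_norm_mul_inner_sq_stdGaussian, integral_norm_pow_six_stdGaussian]
    · simp; ring
    · exact (by simpa using integrable_sq_norm_pow_mul_inner_sq (E := Vec n) 1 a :
        Integrable (fun v : Vec n => ‖v‖ ^ 2 * inner ℝ v a ^ 2) _).const_mul 2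
    · exact (integrable_norm_pow_stdGaussian 6).const_mul _
  have hsec : ∀ z, Measurable fun v => ‖gradEst F μ x z v‖ ^ 2 := fun z =>
    ((measurable_gradEst hF measurable_const measurable_const measurable_id).norm).pow_const 2
  have hint : ∀ᵐ z ∂ν, Integrable (fun v => ‖gradEst F μ x z v‖ ^ 2) (stdGaussian (Vec n)) := by
    filter_upwards [ho.smooth] with z hz
    refine (hbi (∇ (fun y => F y z) x)).mono' (hsec z).aestronglyMeasurable (Filter.Eventually.of_forall fun v => ?_)
    rw [Real.norm_of_nonneg (by positivity)]
    exact norm_gradEst_sq_le hz hμ x v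
  obtain ⟨hg1, hg2⟩ := ho.integrable_norm_gradient_sq hx hM
  have hBi : Integrable (fun z => 2 * (n + 2) * ‖∇ (fun y => F y z) x‖ ^ 2 +
      μ ^ 2 * L ^ 2 / 2 * (n * (n + 2) * (n + 4))) ν :=
    (hg1.const_mul _).add (integrable_const _)
  have hle : ∀ᵐ z ∂ν, ∫ v, ‖gradEst F μ x z v‖ ^ 2 ∂(stdGaussian (Vec n)) ≤
      2 * (n + 2) * ‖∇ (fun y => F y z) x‖ ^ 2 +
      μ ^ 2 * L ^ 2 / 2 * (n * (n + 2) * (n + 4)) := by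
    filter_upwards [ho.smooth, hint] with z hz hzi
    rw [← hbe]
    exact integral_mono hzi (hbi _) fun v => norm_gradEst_sq_le hz hμ x v
  have hprod : Integrable (fun p : Ξ × Vec n => ‖gradEst F μ x p.1 p.2‖ ^ 2)
      (ν.prod (stdGaussian (Vec n))) := by
    rw [integrable_prod_iff hm.aestronglyMeasurable]
    refine ⟨hint, hBi.mono' hm.aestronglyMeasurable.norm.integral_prod_right' ?_⟩
    filter_upwards [hle] with z hz
    simp only [norm_pow, norm_norm]
    rwa [Real.norm_of_nonneg (integral_nonneg fun v => by positivity)]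
  refine ⟨hprod, ?_⟩
  rw [integral_prod _ hprod]
  calc ∫ z, ∫ v, ‖gradEst F μ x z v‖ ^ 2 ∂(stdGaussian (Vec n)) ∂ν
      ≤ ∫ z, (2 * (n + 2) * ‖∇ (fun y => F y z) x‖ ^ 2 +
          μ ^ 2 * L ^ 2 / 2 * (n * (n + 2) * (n + 4))) ∂ν :=
        integral_mono_ae hprod.integral_prod_left hBi hle
    _ = 2 * (n + 2) * ∫ z, ‖∇ (fun y => F y z) x‖ ^ 2 ∂ν +
          μ ^ 2 * L ^ 2 / 2 * (n * (n + 2) * (n + 4)) := by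
        rw [integral_add (hg1.const_mul _) (integrable_const _), integral_const_mul]
        simp
    -- The exact moments are enlarged to the shape of `σ̃²`: `(μ²L²/2) · 4(n + 4)³` equals `2(n + 4)
    -- · μ²L²(n + 4)²`.
    _ ≤ 2 * (n + 4) * (M ^ 2 + σ ^ 2) + μ ^ 2 * L ^ 2 / 2 * (4 * (n + 4) ^ 3) := by
        have h0 : (0 : ℝ) ≤ n := Nat.cast_nonneg n
        have h1 : (n * (n + 2) * (n + 4) : ℝ) ≤ 4 * (n + 4) ^ 3 := by
          nlinarith [mul_nonneg h0 h0, mul_nonneg (mul_nonneg h0 h0) h0]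
        have h2 : (n + 2 : ℝ) ≤ n + 4 := by linarith
        gcongr
    _ = sigmaTildeSq n M σ μ L := by unfold sigmaTildeSq; ring

lemma IsOracle.integrable_gradEst :
    Integrable (fun p : Ξ × Vec n => gradEst F μ x p.1 p.2) (ν.prod (stdGaussian (Vec n))) := by
  have hm : AEStronglyMeasurable (fun p : Ξ × Vec n => gradEst F μ x p.1 p.2)
    (ν.prod (stdGaussian (Vec n))) :=
    (measurable_gradEst hF measurable_const measurable_fst measurable_snd).aestronglyMeasurable
  exact ((memLp_two_iff_integrable_sq_norm hm).2
    (ho.integrable_norm_gradEst_sq hF hμ hx hM).1).integrable one_le_two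

/-- Integrating over the noise first replaces `F` by `f`, so that Stein's identity is needed only
for `f`. -/
lemma IsOracle.integral_gradEst :
    ∫ p, gradEst F μ x p.1 p.2 ∂(ν.prod (stdGaussian (Vec n))) = smoothedGradient μ f x := by
  rw [integral_prod_symm _ (ho.integrable_gradEst hF hμ hx hM),
    ← (ho.isC11 hF hx).integral_quotient_smul hμ x]
  congr 1; ext1 v
  simp only [gradEst]
  rw [integral_smul_const, integral_div,
    integral_sub (ho.integrable_value _) (ho.integrable_value _), ho.mean_value, ho.mean_value]

end

end

-- The estimator at a random point independent of the sample.

section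

variable {n : ℕ} {Ξ Ω : Type*} [MeasurableSpace Ξ] [MeasurableSpace Ω]
  {X : Set (Vec n)} {f : Vec n → ℝ} {F : Vec n → Ξ → ℝ} {L σ μ M : ℝ}

section FixedPoint
variable {ν : Measure Ξ} [IsProbabilityMeasure ν] (ho : IsOracle X f F L σ ν)
  (hF : Measurable (Function.uncurry F)) (hμ : μ ≠ 0) {x : Vec n} (hx : x ∈ X)
  (hM : ‖∇ f x‖ ≤ M)
include ho hF hμ hx hM

/-- At a fixed point of `X` the estimator has mean `∇f_μ` and variance at most `σ̃²`. -/
lemma IsOracle.integral_norm_gradEst_sub_sq_le :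
    Integrable (fun p : Ξ × Vec n => ‖gradEst F μ x p.1 p.2 - smoothedGradient μ f x‖ ^ 2)
      (ν.prod (stdGaussian (Vec n))) ∧
      ∫ p, ‖gradEst F μ x p.1 p.2 - smoothedGradient μ f x‖ ^ 2
        ∂(ν.prod (stdGaussian (Vec n))) ≤ sigmaTildeSq n M σ μ L := by
  obtain ⟨hi, hle⟩ := ho.integrable_norm_gradEst_sq hF hμ hx hM
  have hg := ho.integrable_gradEst hF hμ hx hM
  have hgi : Integrable (fun p : Ξ × Vec n =>
      2 * inner ℝ (gradEst F μ x p.1 p.2) (smoothedGradient μ f x))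
      (ν.prod (stdGaussian (Vec n))) := (hg.inner_const _).const_mul 2
  have hi2 : Integrable (fun p : Ξ × Vec n => ‖gradEst F μ x p.1 p.2‖ ^ 2 -
      2 * inner ℝ (gradEst F μ x p.1 p.2) (smoothedGradient μ f x))
      (ν.prod (stdGaussian (Vec n))) := hi.sub hgi
  simp_rw [norm_sub_sq_real]
  refine ⟨hi2.add (integrable_const _), ?_⟩
  rw [integral_add hi2 (integrable_const _), integral_sub hi hgi, integral_const_mul,
    integral_inner_const_left hg, ho.integral_gradEst hF hμ hx hM, real_inner_self_eq_norm_sq]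
  simp
  nlinarith [sq_nonneg ‖smoothedGradient μ f x‖]

lemma IsOracle.integral_inner_gradEst_sub (b : Vec n) :
    ∫ p, inner ℝ (gradEst F μ x p.1 p.2 - smoothedGradient μ f x) b
        ∂(ν.prod (stdGaussian (Vec n))) = 0 := by
  have hg := ho.integrable_gradEst hF hμ hx hM
  have hi : Integrable (fun p : Ξ × Vec n => gradEst F μ x p.1 p.2 - smoothedGradient μ f x)
      (ν.prod (stdGaussian (Vec n))) := hg.sub (integrable_const _)
  rw [integral_inner_const_left hi,
    integral_sub hg (integrable_const _), ho.integral_gradEst hF hμ hx hM]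
  simp

end FixedPoint

lemma integrable_inner_of_sq {P : Measure Ω} {a b : Ω → Vec n} (ha : Measurable a)
    (hb : Measurable b) (ha2 : Integrable (fun s => ‖a s‖ ^ 2) P)
    (hb2 : Integrable (fun s => ‖b s‖ ^ 2) P) : Integrable (fun s => inner ℝ (a s) (b s)) P := by
  refine (ha2.add hb2).mono' (ha.inner hb).aestronglyMeasurable
    (Filter.Eventually.of_forall fun s => ?_)
  have h1 := norm_inner_le_norm (𝕜 := ℝ) (a s) (b s)
  have h2 := two_mul_le_add_sq ‖a s‖ ‖b s‖
  simp only [Pi.add_apply]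
  nlinarith [mul_nonneg (norm_nonneg (a s)) (norm_nonneg (b s))]

section RandomPoint
variable {P : Measure Ω} [IsProbabilityMeasure P] {u φ : Ω → Vec n} {ζ : Ω → Ξ} {ϑ : Ω → Vec n}
  (hF : Measurable (Function.uncurry F)) (hμ : μ ≠ 0)
  (hX : IsClosed X) (hM : ∀ x ∈ X, ‖∇ f x‖ ≤ M)
  (hf : IsC11 L f)
  (hu : Measurable u) (huX : ∀ s, u s ∈ X) (hφ : Measurable φ) (hζ : Measurable ζ)
  (hϑ : Measurable ϑ) (hlaw : P.map ϑ = stdGaussian (Vec n)) (hind : IndepFun ζ ϑ P)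
  (ho : IsOracle X f F L σ (P.map ζ))
  (hindep : IndepFun (fun s => (u s, φ s)) (fun s => (ζ s, ϑ s)) P)

lemma measurable_smoothedGradient (hf : IsC11 L f) : Measurable (smoothedGradient μ f) := by
  have h := hf.smoothing (μ := μ)
  rw [← h.2]
  exact h.1.continuous_gradient.measurable

include hF hf in
lemma measurable_gradEst_sub {Ω' : Type*} [MeasurableSpace Ω'] {u : Ω' → Vec n} {ζ : Ω' → Ξ}
    {ϑ : Ω' → Vec n} (hu : Measurable u) (hζ : Measurable ζ) (hϑ : Measurable ϑ) :
    Measurable fun s => gradEst F μ (u s) (ζ s) (ϑ s) - smoothedGradient μ f (u s) :=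
  (measurable_gradEst hF hu hζ hϑ).sub ((measurable_smoothedGradient hf).comp hu)

lemma measurable_error_prod (hF : Measurable (Function.uncurry F)) (hf : IsC11 L f) :
    Measurable fun q : (Vec n × Vec n) × (Ξ × Vec n) =>
      gradEst F μ q.1.1 q.2.1 q.2.2 - smoothedGradient μ f q.1.1 :=
  measurable_gradEst_sub hF hf (u := fun q : (Vec n × Vec n) × (Ξ × Vec n) => q.1.1)
    (ζ := fun q : (Vec n × Vec n) × (Ξ × Vec n) => q.2.1)
    (ϑ := fun q : (Vec n × Vec n) × (Ξ × Vec n) => q.2.2)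
    (by fun_prop) (by fun_prop) (by fun_prop)

omit [IsProbabilityMeasure P] in
lemma ae_map_point_mem (hX : IsClosed X) (hu : Measurable u) (huX : ∀ s, u s ∈ X)
    (hφ : Measurable φ) : ∀ᵐ p ∂(P.map fun s => (u s, φ s)), p.1 ∈ X := by
  rw [ae_map_iff (hu.prodMk hφ).aemeasurable (measurable_fst hX.measurableSet)]
  exact Filter.Eventually.of_forall huX

section Transfer
include hu hφ hζ hϑ hlaw hind hindep

/-- Here `φ` is a test vector which, jointly with the point `u`, is independent of the sample. The
product law allows both to be frozen by Fubini. -/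
lemma map_point_sample : P.map (fun s => ((u s, φ s), (ζ s, ϑ s))) =
    (P.map fun s => (u s, φ s)).prod ((P.map ζ).prod (stdGaussian (Vec n))) := by
  rw [(indepFun_iff_map_prod_eq_prod_map_map (hu.prodMk hφ).aemeasurable
    (hζ.prodMk hϑ).aemeasurable).1 hindep,
    (indepFun_iff_map_prod_eq_prod_map_map hζ.aemeasurable hϑ.aemeasurable).1 hind, hlaw]

lemma integrable_point_sample_iff {Φ : (Vec n × Vec n) × (Ξ × Vec n) → ℝ} (hΦ : Measurable Φ) :
    Integrable (fun s => Φ ((u s, φ s), (ζ s, ϑ s))) P ↔ Integrable Φ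
      ((P.map fun s => (u s, φ s)).prod ((P.map ζ).prod (stdGaussian (Vec n)))) := by
  rw [← map_point_sample hu hφ hζ hϑ hlaw hind hindep]
  exact (integrable_map_measure hΦ.aestronglyMeasurable
    ((hu.prodMk hφ).prodMk (hζ.prodMk hϑ)).aemeasurable).symm

lemma integral_point_sample {Φ : (Vec n × Vec n) × (Ξ × Vec n) → ℝ} (hΦ : Measurable Φ) :
    ∫ s, Φ ((u s, φ s), (ζ s, ϑ s)) ∂P = ∫ q, Φ q
      ∂((P.map fun s => (u s, φ s)).prod ((P.map ζ).prod (stdGaussian (Vec n)))) := by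
  rw [← map_point_sample hu hφ hζ hϑ hlaw hind hindep]
  exact (integral_map ((hu.prodMk hφ).prodMk (hζ.prodMk hϑ)).aemeasurable
    hΦ.aestronglyMeasurable).symm

end Transfer

include hF hμ hX hM hf hu huX hφ hζ hϑ hlaw hind ho hindep

lemma integrable_norm_sample_error_sq :
    Integrable (fun s => ‖gradEst F μ (u s) (ζ s) (ϑ s) - smoothedGradient μ f (u s)‖ ^ 2) P ∧
      ∫ s, ‖gradEst F μ (u s) (ζ s) (ϑ s) - smoothedGradient μ f (u s)‖ ^ 2 ∂P ≤
        sigmaTildeSq n M σ μ L := by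
  have hpν : IsProbabilityMeasure (P.map ζ) := Measure.isProbabilityMeasure_map hζ.aemeasurable
  have hpu : IsProbabilityMeasure (P.map fun s => (u s, φ s)) :=
    Measure.isProbabilityMeasure_map (hu.prodMk hφ).aemeasurable
  obtain ⟨Φ, hΦ⟩ : ∃ Φ : (Vec n × Vec n) × (Ξ × Vec n) → ℝ, Φ = fun q =>
    ‖gradEst F μ q.1.1 q.2.1 q.2.2 - smoothedGradient μ f q.1.1‖ ^ 2 := ⟨_, rfl⟩
  have hΦm : Measurable Φ := by
    rw [hΦ]; exact ((measurable_error_prod hF hf).norm).pow_const 2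
  have hΦ0 : ∀ q, 0 ≤ Φ q := fun q => by rw [hΦ]; positivity
  have hsec : ∀ᵐ p ∂(P.map fun s => (u s, φ s)),
      Integrable (fun q => Φ (p, q)) ((P.map ζ).prod (stdGaussian (Vec n))) ∧
      ∫ q, Φ (p, q) ∂((P.map ζ).prod (stdGaussian (Vec n))) ≤ sigmaTildeSq n M σ μ L := by
    filter_upwards [ae_map_point_mem (P := P) hX hu huX hφ] with p hp
    simp only [hΦ]
    exact ho.integral_norm_gradEst_sub_sq_le hF hμ hp (hM _ hp)
  have hint : Integrable Φ
      ((P.map fun s => (u s, φ s)).prod ((P.map ζ).prod (stdGaussian (Vec n)))) := by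
    rw [integrable_prod_iff hΦm.aestronglyMeasurable]
    refine ⟨hsec.mono fun _ h => h.1, (integrable_const (sigmaTildeSq n M σ μ L)).mono'
      hΦm.aestronglyMeasurable.norm.integral_prod_right' ?_⟩
    filter_upwards [hsec] with p hp
    rw [Real.norm_of_nonneg (integral_nonneg fun _ => norm_nonneg _)]
    simp_rw [Real.norm_of_nonneg (hΦ0 _)]
    exact hp.2
  have h1 := (integrable_point_sample_iff hu hφ hζ hϑ hlaw hind hindep hΦm).2 hint
  have h2 := integral_point_sample hu hφ hζ hϑ hlaw hind hindep hΦm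
  have h3 : ∫ q, Φ q ∂((P.map fun s => (u s, φ s)).prod ((P.map ζ).prod (stdGaussian (Vec n)))) ≤
      sigmaTildeSq n M σ μ L := by
    rw [integral_prod _ hint]
    refine (integral_mono_ae hint.integral_prod_left (integrable_const (sigmaTildeSq n M σ μ L))
      (hsec.mono fun _ h => h.2)).trans_eq ?_
    simp
  rw [← h2] at h3
  simp only [hΦ] at h1 h3
  exact ⟨h1, h3⟩

lemma integral_inner_sample_error (hφ2 : Integrable (fun s => ‖φ s‖ ^ 2) P) :
    ∫ s, inner ℝ (gradEst F μ (u s) (ζ s) (ϑ s) - smoothedGradient μ f (u s)) (φ s) ∂P = 0 := by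
  have hpν : IsProbabilityMeasure (P.map ζ) := Measure.isProbabilityMeasure_map hζ.aemeasurable
  have hpu : IsProbabilityMeasure (P.map fun s => (u s, φ s)) :=
    Measure.isProbabilityMeasure_map (hu.prodMk hφ).aemeasurable
  have hη := (integrable_norm_sample_error_sq hF hμ hX hM hf hu huX hφ hζ hϑ hlaw hind ho
    hindep).1
  have hi := integrable_inner_of_sq (measurable_gradEst_sub hF hf hu hζ hϑ) hφ hη hφ2
  obtain ⟨Φ, hΦ⟩ : ∃ Φ : (Vec n × Vec n) × (Ξ × Vec n) → ℝ, Φ = fun q =>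
    inner ℝ (gradEst F μ q.1.1 q.2.1 q.2.2 - smoothedGradient μ f q.1.1) q.1.2 := ⟨_, rfl⟩
  have hΦm : Measurable Φ := by
    rw [hΦ]; exact (measurable_error_prod hF hf).inner (measurable_snd.comp measurable_fst)
  -- Integrability on the product is imported from `Ω`, where it follows from the second moments of
  -- the error and of `φ`.
  have hi' : Integrable (fun s => Φ ((u s, φ s), (ζ s, ϑ s))) P := by simpa only [hΦ] using hi
  have hint := (integrable_point_sample_iff hu hφ hζ hϑ hlaw hind hindep hΦm).1 hi'
  have h2 := integral_point_sample hu hφ hζ hϑ hlaw hind hindep hΦm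
  have h3 : ∫ q, Φ q ∂((P.map fun s => (u s, φ s)).prod
      ((P.map ζ).prod (stdGaussian (Vec n)))) = 0 := by
    rw [integral_prod _ hint]
    refine integral_eq_zero_of_ae ?_
    filter_upwards [ae_map_point_mem (P := P) hX hu huX hφ] with p hp
    simp only [hΦ]
    exact ho.integral_inner_gradEst_sub hF hμ hp (hM _ hp) p.2
  rw [h3] at h2
  simp only [hΦ] at h2
  exact h2

end RandomPoint

end

-- Batches, the history of the run, and the error of one step.

section

variable {n : ℕ} {Ξ Ω : Type*} {X : Set (Vec n)} {f : Vec n → ℝ} {F : Vec n → Ξ → ℝ}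
  {L σ μ M α : ℝ}

/-- Pairwise orthogonality leaves only the `m` diagonal terms of the double sum, against a factor
`1/m²`. -/
lemma integral_norm_average_sq_le [MeasurableSpace Ω] {P : Measure Ω} {m : ℕ} (hm : 1 ≤ m)
    {η : ℕ → Ω → Vec n} {S : ℝ} (hη : ∀ i < m, Measurable (η i))
    (hi : ∀ i < m, Integrable (fun s => ‖η i s‖ ^ 2) P) (hS : ∀ i < m, ∫ s, ‖η i s‖ ^ 2 ∂P ≤ S)
    (h0 : ∀ i < m, ∀ j < m, i ≠ j → ∫ s, inner ℝ (η i s) (η j s) ∂P = 0) :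
    Integrable (fun s => ‖(1 / (m : ℝ)) • ∑ i ∈ Finset.range m, η i s‖ ^ 2) P ∧
      ∫ s, ‖(1 / (m : ℝ)) • ∑ i ∈ Finset.range m, η i s‖ ^ 2 ∂P ≤ S / m := by
  have hm0 : (0 : ℝ) < m := by exact_mod_cast hm
  have e : ∀ s, ‖(1 / (m : ℝ)) • ∑ i ∈ Finset.range m, η i s‖ ^ 2 =
      (1 / (m : ℝ)) ^ 2 * ∑ i ∈ Finset.range m, ∑ j ∈ Finset.range m,
        inner ℝ (η i s) (η j s) := fun s => by
    rw [norm_smul, mul_pow, Real.norm_eq_abs, sq_abs, ← real_inner_self_eq_norm_sq, sum_inner]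
    simp_rw [inner_sum]
  have hij : ∀ i ∈ Finset.range m, ∀ j ∈ Finset.range m,
      Integrable (fun s => inner ℝ (η i s) (η j s)) P := fun i hi' j hj => by
    rw [Finset.mem_range] at hi' hj
    exact integrable_inner_of_sq (hη i hi') (hη j hj) (hi i hi') (hi j hj)
  have hsum : ∀ i ∈ Finset.range m, Integrable (fun s => ∑ j ∈ Finset.range m,
      inner ℝ (η i s) (η j s)) P := fun i hi' => integrable_finsetSum _ (hij i hi')
  simp_rw [e]
  refine ⟨(integrable_finsetSum _ hsum).const_mul _, ?_⟩
  rw [integral_const_mul, integral_finsetSum _ hsum]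
  have h1 : ∑ i ∈ Finset.range m, ∫ s, ∑ j ∈ Finset.range m, inner ℝ (η i s) (η j s) ∂P ≤
      m * S := by
    refine (Finset.sum_le_card_nsmul _ _ S fun i hi' => ?_).trans_eq (by simp)
    rw [integral_finsetSum _ (hij i hi'), Finset.sum_eq_single i]
    · simp_rw [real_inner_self_eq_norm_sq]
      exact hS i (Finset.mem_range.1 hi')
    · intro j hj hne
      exact h0 i (Finset.mem_range.1 hi') j (Finset.mem_range.1 hj) hne.symm
    · exact fun h => absurd hi' h
  calc _ ≤ (1 / (m : ℝ)) ^ 2 * (m * S) := by gcongr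
    _ = S / m := by field_simp

section SampleSigma
variable [MeasurableSpace Ξ]

/-- The σ-algebra generated by the samples with index in `T`. -/
@[reducible] def sampleSigma (ξ : ℕ → ℕ → Ω → Ξ) (v : ℕ → ℕ → Ω → Vec n) (T : Set (ℕ × ℕ)) :
    MeasurableSpace Ω :=
  ⨆ p ∈ T, MeasurableSpace.comap (fun s => (ξ p.1 p.2 s, v p.1 p.2 s)) inferInstance

variable {ξ : ℕ → ℕ → Ω → Ξ} {v : ℕ → ℕ → Ω → Vec n}

lemma sampleSigma_mono {S T : Set (ℕ × ℕ)} (h : S ⊆ T) :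
    sampleSigma ξ v S ≤ sampleSigma ξ v T := biSup_mono h

lemma measurable_sampleSigma {T : Set (ℕ × ℕ)} {k i : ℕ} (h : (k, i) ∈ T) :
    Measurable[sampleSigma ξ v T] (ξ k i) ∧ Measurable[sampleSigma ξ v T] (v k i) := by
  have h1 : Measurable[sampleSigma ξ v T] (fun s => (ξ k i s, v k i s)) := by
    rw [measurable_iff_comap_le]
    exact le_biSup (fun p : ℕ × ℕ => MeasurableSpace.comap
      (fun s => (ξ p.1 p.2 s, v p.1 p.2 s)) inferInstance) h
  exact ⟨measurable_fst.comp h1, measurable_snd.comp h1⟩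

variable [MeasurableSpace Ω] {P : Measure Ω} {γ : ℕ → ℝ} {N : ℕ} {R : Ω → ℕ}

lemma IsSampling.comap_le (hs : IsSampling P α L γ N ξ v R) (p : ℕ × ℕ) :
    MeasurableSpace.comap (fun s => (ξ p.1 p.2 s, v p.1 p.2 s)) inferInstance ≤
      (inferInstance : MeasurableSpace Ω) :=
  ((hs.measurable_noise p.1 p.2).prodMk (hs.measurable_dir p.1 p.2)).comap_le

lemma IsSampling.sampleSigma_le (hs : IsSampling P α L γ N ξ v R) (T : Set (ℕ × ℕ)) :
    sampleSigma ξ v T ≤ (inferInstance : MeasurableSpace Ω) :=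
  iSup₂_le fun p _ => hs.comap_le p

/-- The blocks `T` and `{(k, i)}` of a mutually independent family are disjoint. -/
lemma IsSampling.indepFun_sample (hs : IsSampling P α L γ N ξ v R) {T : Set (ℕ × ℕ)} {k i : ℕ}
    (h : (k, i) ∉ T) {β : Type*} [MeasurableSpace β] {A : Ω → β}
    (hA : Measurable[sampleSigma ξ v T] A) :
    IndepFun A (fun s => (ξ k i s, v k i s)) P := by
  have h1 := indep_iSup_of_disjoint hs.comap_le
    ((iIndepFun_iff_iIndep _ _ _).1 hs.indep_samples) (Set.disjoint_singleton_right.2 h)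
  rw [IndepFun_iff_Indep]
  refine indep_of_indep_of_le_left (indep_of_indep_of_le_right h1 ?_) hA.comap_le
  exact le_biSup (fun p : ℕ × ℕ => MeasurableSpace.comap
      (fun s => (ξ p.1 p.2 s, v p.1 p.2 s)) inferInstance) (Set.mem_singleton (k, i))

lemma IsSampling.indepFun_index (hs : IsSampling P α L γ N ξ v R) {β : Type*} [MeasurableSpace β]
    {A : Ω → β} (hA : Measurable[sampleSigma ξ v Set.univ] A) : IndepFun A R P := by
  have h1 := (IndepFun_iff_Indep _ _ _).1 hs.indep_index
  rw [IndepFun_iff_Indep]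
  refine indep_of_indep_of_le_left h1 (hA.comap_le.trans (iSup₂_le fun p _ => ?_))
  rw [← measurable_iff_comap_le]
  have h2 : Measurable fun z : ℕ × ℕ → Ξ × Vec n => z p := measurable_pi_apply p
  exact h2.comp (comap_measurable fun s (p : ℕ × ℕ) => (ξ p.1 p.2 s, v p.1 p.2 s))

end SampleSigma

section Iterates
variable {w : Vec n → ℝ} {dw : Vec n → Vec n} {h : Vec n → ℝ} {γ : ℕ → ℝ} {N : ℕ}
  {batch : ℕ → ℕ} {x₁ : Vec n}

lemma iterate_succ_eq (z : ℕ → ℕ → Ξ) (v : ℕ → ℕ → Vec n) {k : ℕ} (hk : 1 ≤ k) :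
    iterate X w dw h F μ γ batch x₁ z v (k + 1) =
      genProj X w dw h (iterate X w dw h F μ γ batch x₁ z v k)
        (batchEst F μ (batch k) (iterate X w dw h F μ γ batch x₁ z v k) (z k) (v k)) (γ k) := by
  obtain ⟨k, rfl⟩ := Nat.exists_eq_add_of_le' hk
  rw [iterate]

/-- Stepsizes are known to be positive only for steps `1, …, N`, hence the range up to `N + 1`. -/
lemma iterate_mem (hproj : ∀ x ∈ X, ∀ (g : Vec n) (c : ℝ), 0 < c → ∃ u, IsGenProj X w dw h x g c u)
    (hγ : ∀ k ∈ Finset.Icc 1 N, 0 < γ k) (hx₁ : x₁ ∈ X) (z : ℕ → ℕ → Ξ) (v : ℕ → ℕ → Vec n) {k : ℕ}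
    (hk : k ≤ N + 1) : iterate X w dw h F μ γ batch x₁ z v k ∈ X := by
  induction k with
  | zero => simpa only [iterate] using hx₁
  | succ k ih =>
    rcases Nat.eq_zero_or_pos k with rfl | h0
    · simpa only [iterate] using hx₁
    · rw [iterate_succ_eq z v h0]
      exact (isGenProj_genProj (hproj _ (ih (by omega)) _ _
        (hγ k (Finset.mem_Icc.2 ⟨h0, by omega⟩)))).1

lemma measurable_batchEst [MeasurableSpace Ξ] [MeasurableSpace Ω]
    (hF : Measurable (Function.uncurry F)) {m : ℕ} {u : Ω → Vec n} {ζ : ℕ → Ω → Ξ}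
    {ϑ : ℕ → Ω → Vec n} (hu : Measurable u) (hζ : ∀ i < m, Measurable (ζ i))
    (hϑ : ∀ i < m, Measurable (ϑ i)) :
    Measurable fun s => batchEst F μ m (u s) (fun i => ζ i s) (fun i => ϑ i s) := by
  unfold batchEst
  have h1 : Measurable fun s => ∑ i ∈ Finset.range m, gradEst F μ (u s) (ζ i s) (ϑ i s) :=
    Finset.measurable_fun_sum _ fun i hi => measurable_gradEst hF hu
      (hζ i (Finset.mem_range.1 hi)) (hϑ i (Finset.mem_range.1 hi))
  exact h1.const_smul (1 / (m : ℝ))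

variable [MeasurableSpace Ξ] [MeasurableSpace Ω]
  (hw : IsDistanceGenerating X α w dw) (hX : Convex ℝ X) (hα : 0 < α)
  (hh : ConvexOn ℝ X h)
  (hproj : ∀ x ∈ X, ∀ (g : Vec n) (c : ℝ), 0 < c → ∃ u, IsGenProj X w dw h x g c u)
  (hF : Measurable (Function.uncurry F))
  (hγ : ∀ k ∈ Finset.Icc 1 N, 0 < γ k) (hx₁ : x₁ ∈ X)
  {ξ : ℕ → ℕ → Ω → Ξ} {v : ℕ → ℕ → Ω → Vec n}
include hw hX hα hh hproj hF hγ hx₁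

/-- Only samples of steps before `k` are assumed measurable, and the σ-algebra on `Ω` is arbitrary.
Taking the one generated by those samples shows that `x_k` depends on the past alone. -/
lemma measurable_iterate {k : ℕ} (hk : k ≤ N + 1)
    (hξ : ∀ j < k, ∀ i, Measurable (ξ j i)) (hv : ∀ j < k, ∀ i, Measurable (v j i)) :
    Measurable fun s => iterate X w dw h F μ γ batch x₁ (fun j i => ξ j i s)
      (fun j i => v j i s) k := by
  induction k with
  | zero => simp only [iterate]; exact measurable_const
  | succ k ih =>
    rcases Nat.eq_zero_or_pos k with rfl | h0
    · simp only [iterate]; exact measurable_const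
    · have hu := ih (by omega) (fun j hj => hξ j (by omega)) (fun j hj => hv j (by omega))
      simp_rw [iterate_succ_eq _ _ h0]
      exact measurable_genProj hw hX hα hh hproj (hγ k (Finset.mem_Icc.2 ⟨h0, by omega⟩)) hu
        (measurable_batchEst hF hu (fun i _ => hξ k (by omega) i) (fun i _ => hv k (by omega) i))
        (fun s => iterate_mem hproj hγ hx₁ _ _ (by omega))

lemma measurable_comp_iterate {k : ℕ} (hk : k ≤ N + 1)
    (hξ : ∀ j < k, ∀ i, Measurable (ξ j i)) (hv : ∀ j < k, ∀ i, Measurable (v j i)) :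
    Measurable fun s => h (iterate X w dw h F μ γ batch x₁ (fun j i => ξ j i s)
      (fun j i => v j i s) k) := by
  rcases k with _ | k
  · simp only [iterate]; exact measurable_const
  · rcases Nat.eq_zero_or_pos k with rfl | h0
    · simp only [iterate]; exact measurable_const
    · have hu := measurable_iterate (μ := μ) (batch := batch) hw hX hα hh hproj hF hγ hx₁
        (by omega : k ≤ N + 1) (fun j hj => hξ j (by omega)) (fun j hj => hv j (by omega))
      simp_rw [iterate_succ_eq _ _ h0]
      exact measurable_comp_genProj hw hX hα hh hproj (hγ k (Finset.mem_Icc.2 ⟨h0, by omega⟩)) hu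
        (measurable_batchEst hF hu (fun i _ => hξ k (by omega) i) (fun i _ => hv k (by omega) i))
        (fun s => iterate_mem hproj hγ hx₁ _ _ (by omega))

end Iterates

section StepError
variable [MeasurableSpace Ξ] [MeasurableSpace Ω] {P : Measure Ω} [IsProbabilityMeasure P]
  {γ : ℕ → ℝ} {N : ℕ} {R : Ω → ℕ} {ξ : ℕ → ℕ → Ω → Ξ} {v : ℕ → ℕ → Ω → Vec n}
  (hs : IsSampling P α L γ N ξ v R) (ho : ∀ k i, IsOracle X f F L σ (P.map (ξ k i)))
  (hF : Measurable (Function.uncurry F)) (hμ : μ ≠ 0) (hX : IsClosed X)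
  (hM : ∀ x ∈ X, ‖∇ f x‖ ≤ M) (hf : IsC11 L f) {m k : ℕ} (hm : 1 ≤ m) {u : Ω → Vec n}
  (hu : Measurable[sampleSigma ξ v {p | p.1 < k}] u) (huX : ∀ s, u s ∈ X)
  {δ : Ω → Vec n} (hδ : δ = fun s => batchEst F μ m (u s) (fun i => ξ k i s) (fun i => v k i s) -
    smoothedGradient μ f (u s))

omit [MeasurableSpace Ξ] [MeasurableSpace Ω] in
include hm hδ in
lemma stepError_eq_average : δ = fun s => (1 / (m : ℝ)) • ∑ i ∈ Finset.range m,
    (gradEst F μ (u s) (ξ k i s) (v k i s) - smoothedGradient μ f (u s)) := by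
  have hm0 : (m : ℝ) ≠ 0 := by positivity
  rw [hδ]
  ext1 s
  rw [Finset.sum_sub_distrib, smul_sub, batchEst]
  congr 1
  rw [Finset.sum_const, Finset.card_range, ← Nat.cast_smul_eq_nsmul ℝ, smul_smul,
    one_div_mul_cancel hm0, one_smul]

omit [IsProbabilityMeasure P] in
include hs hF hf hu hδ in
lemma measurable_stepError : Measurable δ := by
  have hu' := hu.mono (hs.sampleSigma_le _) le_rfl
  rw [hδ]
  exact (measurable_batchEst hF hu' (fun i _ => hs.measurable_noise k i)
    (fun i _ => hs.measurable_dir k i)).sub ((measurable_smoothedGradient hf).comp hu')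

include hs ho hF hμ hX hM hf hm hu huX hδ

lemma integrable_norm_stepError_sq : Integrable (fun s => ‖δ s‖ ^ 2) P ∧
    ∫ s, ‖δ s‖ ^ 2 ∂P ≤ sigmaTildeSq n M σ μ L / m := by
  have hu' := hu.mono (hs.sampleSigma_le _) le_rfl
  have hkey : ∀ i, ∀ (φ : Ω → Vec n) (T : Set (ℕ × ℕ)), {p | p.1 < k} ⊆ T → (k, i) ∉ T →
      Measurable[sampleSigma ξ v T] φ →
      IndepFun (fun s => (u s, φ s)) (fun s => (ξ k i s, v k i s)) P := fun i φ T hT hi hφ =>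
    hs.indepFun_sample hi ((hu.mono (sampleSigma_mono hT) le_rfl).prodMk hφ)
  -- Second moments need no test vector, so a constant one is supplied.
  have hsq := fun i => integrable_norm_sample_error_sq hF hμ hX hM hf hu' huX measurable_const
    (hs.measurable_noise k i) (hs.measurable_dir k i) (hs.law_dir k i) (hs.indep_noise_dir k i)
    (ho k i) (hkey i (fun _ => (0 : Vec n)) _ subset_rfl (by simp) measurable_const)
  rw [stepError_eq_average hm hδ]
  refine integral_norm_average_sq_le hm
    (fun i _ => measurable_gradEst_sub hF hf hu' (hs.measurable_noise k i) (hs.measurable_dir k i))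
    (fun i _ => (hsq i).1) (fun i _ => (hsq i).2) fun i _ j _ hij => ?_
  -- For the cross terms, sample `j` is added to the past: its error becomes the test vector, and
  -- sample `i ≠ j` is still independent of the enlarged block.
  have hT : {p : ℕ × ℕ | p.1 < k} ⊆ {p | p.1 < k ∨ p = (k, j)} := fun p hp => Or.inl hp
  have hmj := measurable_sampleSigma (ξ := ξ) (v := v)
    (T := {p : ℕ × ℕ | p.1 < k ∨ p = (k, j)}) (k := k) (i := j) (Or.inr rfl)
  have hφ := @measurable_gradEst_sub n Ξ _ f F L μ hF hf Ω
    (sampleSigma ξ v {p : ℕ × ℕ | p.1 < k ∨ p = (k, j)}) u (ξ k j) (v k j)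
    (hu.mono (sampleSigma_mono hT) le_rfl) hmj.1 hmj.2
  exact integral_inner_sample_error hF hμ hX hM hf hu' huX
    (hφ.mono (hs.sampleSigma_le _) le_rfl)
    (hs.measurable_noise k i) (hs.measurable_dir k i) (hs.law_dir k i) (hs.indep_noise_dir k i)
    (ho k i) (hkey i _ _ hT (by simp [hij]) hφ) (hsq j).1

lemma integral_inner_stepError {φ : Ω → Vec n}
    (hφ : Measurable[sampleSigma ξ v {p | p.1 < k}] φ)
    (hφ2 : Integrable (fun s => ‖φ s‖ ^ 2) P) :
    Integrable (fun s => inner ℝ (δ s) (φ s)) P ∧ ∫ s, inner ℝ (δ s) (φ s) ∂P = 0 := by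
  have hu' := hu.mono (hs.sampleSigma_le _) le_rfl
  have hφ' := hφ.mono (hs.sampleSigma_le _) le_rfl
  have hδm := measurable_stepError hs hF hf hu hδ
  refine ⟨integrable_inner_of_sq hδm hφ'
    (integrable_norm_stepError_sq hs ho hF hμ hX hM hf hm hu huX hδ).1 hφ2, ?_⟩
  have hind : ∀ i, IndepFun (fun s => (u s, φ s)) (fun s => (ξ k i s, v k i s)) P := fun i =>
    hs.indepFun_sample (T := {p | p.1 < k}) (by simp) (hu.prodMk hφ)
  have hη := fun i => measurable_gradEst_sub (μ := μ) hF hf hu' (hs.measurable_noise k i)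
    (hs.measurable_dir k i)
  have hsq := fun i => integrable_norm_sample_error_sq hF hμ hX hM hf hu' huX hφ'
    (hs.measurable_noise k i) (hs.measurable_dir k i) (hs.law_dir k i) (hs.indep_noise_dir k i)
    (ho k i) (hind i)
  rw [stepError_eq_average hm hδ]
  simp_rw [inner_smul_left, sum_inner]
  rw [integral_const_mul, integral_finsetSum _ fun i _ =>
    integrable_inner_of_sq (hη i) hφ' (hsq i).1 hφ2, Finset.sum_eq_zero, mul_zero]
  exact fun i _ => integral_inner_sample_error hF hμ hX hM hf hu' huX hφ'
    (hs.measurable_noise k i) (hs.measurable_dir k i) (hs.law_dir k i) (hs.indep_noise_dir k i)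
    (ho k i) (hind i) hφ2

end StepError

end

-- Deterministic step inequalities, telescoping, and the random index.

section

section Steps
variable {n : ℕ} {X : Set (Vec n)} {α : ℝ} {w : Vec n → ℝ} {dw : Vec n → Vec n} {h : Vec n → ℝ}
  {L γ : ℝ} {φ : Vec n → ℝ} {x g g' : Vec n}

/-- The projection is `γ/α`-Lipschitz in `g`; dividing by `γ` makes the constant independent of the
stepsize. -/
lemma norm_projGrad_sub_le (hw : IsDistanceGenerating X α w dw) (hX : Convex ℝ X) (hα : 0 < α)
    (hh : ConvexOn ℝ X h)
    (hproj : ∀ x ∈ X, ∀ (g : Vec n) (c : ℝ), 0 < c → ∃ u, IsGenProj X w dw h x g c u)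
    (hx : x ∈ X) (hγ : 0 < γ) :
    ‖projGrad X w dw h x g γ - projGrad X w dw h x g' γ‖ ≤ ‖g - g'‖ / α := by
  have h1 := (isGenProj_genProj (hproj x hx g γ hγ)).norm_sub_le hw hX hα hh hγ
    (isGenProj_genProj (hproj x hx g' γ hγ))
  rw [sub_self, norm_zero, mul_zero, add_zero] at h1
  rw [projGrad, projGrad, ← smul_sub, sub_sub_sub_cancel_left, norm_smul, norm_sub_rev,
    Real.norm_of_nonneg (by positivity)]
  calc 1 / γ * ‖genProj X w dw h x g γ - genProj X w dw h x g' γ‖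
      ≤ 1 / γ * (γ / α * ‖g - g'‖) := by gcongr
    _ = _ := by field_simp

variable (hw : IsDistanceGenerating X α w dw) (hX : Convex ℝ X) (hα : 0 < α)
  (hh : ConvexOn ℝ X h)
  (hproj : ∀ x ∈ X, ∀ (g : Vec n) (c : ℝ), 0 < c → ∃ u, IsGenProj X w dw h x g c u)
  (hL : 0 < L) (hφ : IsC11 L φ) (hx : x ∈ X) (hγ : γ = α / (2 * L))
include hw hX hα hh hproj hL hφ hx hγ

/-- One step of the projected gradient method decreases the composite objective. -/
lemma descent_step (g : Vec n) :
    α ^ 2 / (4 * L) * ‖projGrad X w dw h x g γ‖ ^ 2 + Psi φ h (genProj X w dw h x g γ) ≤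
      Psi φ h x + γ * inner ℝ (g - ∇ φ x) (projGrad X w dw h x (∇ φ x) γ) +
        1 / (2 * L) * ‖g - ∇ φ x‖ ^ 2 := by
  have hγ0 : 0 < γ := by rw [hγ]; positivity
  have hu := isGenProj_genProj (hproj x hx g γ hγ0)
  have h1 := hφ.sub_le x (genProj X w dw h x g γ)
  have h2 := hu.le_inner hw hX hh hγ0 hx
  have h3 := norm_projGrad_sub_le hw hX hα hh hproj hx hγ0 (g := g) (g' := ∇ φ x)
  set q := projGrad X w dw h x g γ with hq
  set q' := projGrad X w dw h x (∇ φ x) γ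
  set u := genProj X w dw h x g γ
  set δ := g - ∇ φ x with hδ
  have e : x - u = γ • q := by rw [hq, projGrad, smul_smul, mul_one_div_cancel hγ0.ne', one_smul]
  have e' : u - x = -(γ • q) := by rw [← e, neg_sub]
  rw [e, norm_smul, inner_smul_right, Real.norm_of_nonneg hγ0.le] at h2
  rw [e', inner_neg_right, inner_smul_right, norm_neg, norm_smul,
    Real.norm_of_nonneg hγ0.le] at h1
  have h4 : inner ℝ g q = inner ℝ (∇ φ x) q + inner ℝ δ q := by
    rw [hδ, inner_sub_left]; ring
  -- The error `δ` is correlated with `q`, which depends on `g`. Replacing `q` by the noise-free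
  -- `q'` leaves a term of mean zero, at the cost of `γ‖δ‖²/α = ‖δ‖²/(2L)`.
  have h5 : inner ℝ δ q = inner ℝ δ q' + inner ℝ δ (q - q') := by
    rw [inner_sub_right]; ring
  have h6 : inner ℝ δ (q - q') ≤ ‖δ‖ ^ 2 / α := by
    refine (real_inner_le_norm _ _).trans ?_
    rw [pow_two, mul_div_assoc]
    gcongr
  have h7 : γ * inner ℝ δ (q - q') ≤ 1 / (2 * L) * ‖δ‖ ^ 2 := by
    calc γ * inner ℝ δ (q - q') ≤ γ * (‖δ‖ ^ 2 / α) := by gcongr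
      _ = _ := by rw [hγ]; field_simp
  have h8 : α / γ * (γ * ‖q‖) ^ 2 = α ^ 2 / (2 * L) * ‖q‖ ^ 2 := by
    rw [hγ]; field_simp
  have h9 : L / 2 * (γ * ‖q‖) ^ 2 = α ^ 2 / (8 * L) * ‖q‖ ^ 2 := by
    rw [hγ]; field_simp; ring
  -- The available decrease is `1/2 - 1/8 = 3/8` of `α²/L`; only `1/4` is kept.
  have h10 : α ^ 2 / (4 * L) * ‖q‖ ^ 2 + α ^ 2 / (8 * L) * ‖q‖ ^ 2 ≤
      α ^ 2 / (2 * L) * ‖q‖ ^ 2 := by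
    have : α ^ 2 / (2 * L) * ‖q‖ ^ 2 = α ^ 2 / (4 * L) * ‖q‖ ^ 2 + α ^ 2 / (8 * L) * ‖q‖ ^ 2 +
        α ^ 2 / (8 * L) * ‖q‖ ^ 2 := by field_simp; ring
    rw [this]
    have : 0 ≤ α ^ 2 / (8 * L) * ‖q‖ ^ 2 := by positivity
    linarith
  rw [h8, h4, h5] at h2
  rw [h9] at h1
  simp only [Psi]
  linarith

/-- One step of the projected gradient method compared with a point of `X` at which the smooth
part lies above its linearization. -/
lemma convex_step (g : Vec n) {y : Vec n} (hy : y ∈ X)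
    (hc : φ x + inner ℝ (∇ φ x) (y - x) ≤ φ y) :
    Psi φ h (genProj X w dw h x g γ) - Psi φ h y ≤
      2 * L / α * (proxFun w dw y x - proxFun w dw y (genProj X w dw h x g γ)) +
        1 / (2 * L) * ‖g - ∇ φ x‖ ^ 2 - inner ℝ (g - ∇ φ x) (x - y) := by
  have hγ0 : 0 < γ := by rw [hγ]; positivity
  have hu := isGenProj_genProj (hproj x hx g γ hγ0)
  set u := genProj X w dw h x g γ
  have h1 := hφ.sub_le x u
  have h2 := hu.three_point hw hX hh hy
  have h3 := hw.le_proxFun hX hu.1 hx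
  set δ := g - ∇ φ x with hδ
  have e : 1 / γ = 2 * L / α := by rw [hγ, one_div_div]
  have h4 : inner ℝ g (u - y) = inner ℝ (∇ φ x) (u - x) - inner ℝ (∇ φ x) (y - x) +
      inner ℝ δ (u - x) + inner ℝ δ (x - y) := by
    simp only [hδ, inner_sub_left, inner_sub_right]; ring
  -- Young's inequality with weight `L`: together with the `L/2` of the descent lemma it costs `L‖u
  -- - x‖²`, exactly what `V(u, x)/γ` absorbs.
  have h5 : - (L / 2 * ‖u - x‖ ^ 2) - 1 / (2 * L) * ‖δ‖ ^ 2 ≤ inner ℝ δ (u - x) := by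
    have h6 := (abs_le.1 (abs_real_inner_le_norm δ (u - x))).1
    have h7 : L / 2 * ‖u - x‖ ^ 2 + 1 / (2 * L) * ‖δ‖ ^ 2 - ‖δ‖ * ‖u - x‖ =
        1 / (2 * L) * (L * ‖u - x‖ - ‖δ‖) ^ 2 := by field_simp; ring
    have h8 : 0 ≤ 1 / (2 * L) * (L * ‖u - x‖ - ‖δ‖) ^ 2 := by positivity
    linarith
  have h9 : L * ‖u - x‖ ^ 2 ≤ 2 * L / α * proxFun w dw u x := by
    calc L * ‖u - x‖ ^ 2 = 2 * L / α * (α / 2 * ‖u - x‖ ^ 2) := by field_simp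
      _ ≤ _ := by gcongr
  rw [h4, e] at h2
  simp only [Psi]
  linarith

end Steps

section Telescoping
variable {Ω : Type*} [MeasurableSpace Ω] {P : Measure Ω} [IsProbabilityMeasure P]

/-- A stochastic descent recursion, summed over the steps `1, …, N`. -/
lemma sum_integral_le_of_descent {N : ℕ} {c d γ lo K : ℝ} (hc : 0 < c)
    {A B D I Φ : ℕ → Ω → ℝ}
    (hstep : ∀ k ∈ Finset.Icc 1 N, ∀ s, c * A k s + Φ (k + 1) s ≤
      Φ k s + γ * I k s + d * D k s)
    (hB : ∀ k ∈ Finset.Icc 1 N, ∀ s, c * B k s + lo ≤ Φ k s)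
    (hlo : ∀ s, lo ≤ Φ (N + 1) s) (hK : ∀ s, Φ 1 s ≤ K)
    (hA0 : ∀ k s, 0 ≤ A k s) (hB0 : ∀ k s, 0 ≤ B k s)
    (hAm : ∀ k ∈ Finset.Icc 1 N, Measurable (A k))
    (hBm : ∀ k ∈ Finset.Icc 1 N, Measurable (B k))
    (hD : ∀ k ∈ Finset.Icc 1 N, Integrable (D k) P)
    (hI : ∀ k ∈ Finset.Icc 1 N, Integrable (B k) P → Integrable (I k) P ∧ ∫ s, I k s ∂P = 0) :
    (∀ k ∈ Finset.Icc 1 N, Integrable (A k) P ∧ Integrable (B k) P) ∧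
      c * ∑ k ∈ Finset.Icc 1 N, ∫ s, A k s ∂P ≤
        K - lo + d * ∑ k ∈ Finset.Icc 1 N, ∫ s, D k s ∂P := by
  have hBi : ∀ k ∈ Finset.Icc 1 N, ∀ β : Ω → ℝ, Integrable β P → (∀ s, Φ k s ≤ β s) →
      Integrable (B k) P := fun k hk β hβ hle => by
    refine ((hβ.sub (integrable_const lo)).const_mul c⁻¹).mono' (hBm k hk).aestronglyMeasurable
      (Filter.Eventually.of_forall fun s => ?_)
    rw [Real.norm_of_nonneg (hB0 k s), inv_mul_eq_div, le_div_iff₀ hc]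
    simp only [Pi.sub_apply]
    linarith [hB k hk s, hle s]
  -- The potentials `Φ k` need not be measurable; each receives an integrable majorant by induction.
  -- A majorant makes `B k` integrable, hence also `I k`, which yields the next majorant.
  have hbound : ∀ k, k ≤ N → ∃ β : Ω → ℝ, Integrable β P ∧ ∀ s, Φ (k + 1) s ≤ β s := by
    intro k
    induction k with
    | zero => exact fun _ => ⟨fun _ => K, integrable_const K, hK⟩
    | succ k ih =>
      intro hk
      obtain ⟨β, hβ, hle⟩ := ih (by omega)
      have hk' : k + 1 ∈ Finset.Icc 1 N := Finset.mem_Icc.2 ⟨by omega, hk⟩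
      have hIk := (hI _ hk' (hBi _ hk' β hβ hle)).1
      refine ⟨fun s => β s + γ * I (k + 1) s + d * D (k + 1) s,
        (hβ.add (hIk.const_mul γ)).add ((hD _ hk').const_mul d), fun s => ?_⟩
      have := mul_nonneg hc.le (hA0 (k + 1) s)
      linarith [hstep _ hk' s, hle s]
  have hBint : ∀ k ∈ Finset.Icc 1 N, Integrable (B k) P := fun k hk => by
    obtain ⟨hk1, hk2⟩ := Finset.mem_Icc.1 hk
    obtain ⟨j, rfl⟩ := Nat.exists_eq_add_of_le' hk1
    obtain ⟨β, hβ, hle⟩ := hbound j (by omega)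
    exact hBi _ hk β hβ hle
  have hlo' : ∀ k ∈ Finset.Icc 1 N, ∀ s, lo ≤ Φ (k + 1) s := fun k hk s => by
    obtain ⟨hk1, hk2⟩ := Finset.mem_Icc.1 hk
    rcases hk2.eq_or_lt with rfl | hlt
    · exact hlo s
    · have := mul_nonneg hc.le (hB0 (k + 1) s)
      linarith [hB (k + 1) (Finset.mem_Icc.2 ⟨by omega, by omega⟩) s]
  have hAint : ∀ k ∈ Finset.Icc 1 N, Integrable (A k) P := fun k hk => by
    obtain ⟨hk1, hk2⟩ := Finset.mem_Icc.1 hk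
    obtain ⟨j, rfl⟩ := Nat.exists_eq_add_of_le' hk1
    obtain ⟨β, hβ, hle⟩ := hbound j (by omega)
    have hb : Integrable (fun s => β s + γ * I (j + 1) s + d * D (j + 1) s - lo) P :=
      ((hβ.add ((hI _ hk (hBint _ hk)).1.const_mul γ)).add ((hD _ hk).const_mul d)).sub
        (integrable_const lo)
    refine (hb.const_mul c⁻¹).mono' (hAm _ hk).aestronglyMeasurable
      (Filter.Eventually.of_forall fun s => ?_)
    rw [Real.norm_of_nonneg (hA0 _ s), inv_mul_eq_div, le_div_iff₀ hc]
    linarith [hstep _ hk s, hle s, hlo' _ hk s]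
  refine ⟨fun k hk => ⟨hAint k hk, hBint k hk⟩, ?_⟩
  have htel : ∀ s, c * ∑ k ∈ Finset.Icc 1 N, A k s ≤
      K - lo + (γ * ∑ k ∈ Finset.Icc 1 N, I k s + d * ∑ k ∈ Finset.Icc 1 N, D k s) := fun s => by
    have h1 : ∑ k ∈ Finset.Icc 1 N, (Φ (k + 1) s - Φ k s) = Φ (N + 1) s - Φ 1 s := by
      rw [← Finset.Ico_add_one_right_eq_Icc, Finset.sum_Ico_sub (fun k => Φ k s) (by omega)]
    have h2 : ∑ k ∈ Finset.Icc 1 N, c * A k s ≤ ∑ k ∈ Finset.Icc 1 N,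
        (γ * I k s + d * D k s - (Φ (k + 1) s - Φ k s)) :=
      Finset.sum_le_sum fun k hk => by linarith [hstep k hk s]
    rw [Finset.sum_sub_distrib, h1, Finset.sum_add_distrib, ← Finset.mul_sum, ← Finset.mul_sum,
      ← Finset.mul_sum] at h2
    linarith [hlo s, hK s]
  have hsA : Integrable (fun s => ∑ k ∈ Finset.Icc 1 N, A k s) P :=
    integrable_finsetSum _ hAint
  have hsI : Integrable (fun s => ∑ k ∈ Finset.Icc 1 N, I k s) P :=
    integrable_finsetSum _ fun k hk => (hI k hk (hBint k hk)).1
  have hsD : Integrable (fun s => ∑ k ∈ Finset.Icc 1 N, D k s) P :=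
    integrable_finsetSum _ hD
  have hr : Integrable (fun s => γ * ∑ k ∈ Finset.Icc 1 N, I k s +
      d * ∑ k ∈ Finset.Icc 1 N, D k s) P := (hsI.const_mul γ).add (hsD.const_mul d)
  have hfin := integral_mono (hsA.const_mul c) ((integrable_const (K - lo)).add hr) htel
  simp only [Pi.add_apply] at hfin
  rw [integral_const_mul, integral_add (integrable_const _) hr,
    integral_add (hsI.const_mul γ) (hsD.const_mul d), integral_const_mul, integral_const_mul,
    integral_finsetSum _ hAint, integral_finsetSum _ hD,
    integral_finsetSum _ fun k hk => (hI k hk (hBint k hk)).1,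
    Finset.sum_eq_zero fun k hk => (hI k hk (hBint k hk)).2] at hfin
  simpa using hfin

/-- Nonnegative terms dominated, after summation over the steps, by a martingale difference and
an integrable error. -/
lemma sum_integral_le_of_sum_le {N : ℕ} {d K : ℝ} {A D I : ℕ → Ω → ℝ}
    (hle : ∀ s, ∑ k ∈ Finset.Icc 1 N, A k s ≤
      K + (d * ∑ k ∈ Finset.Icc 1 N, D k s - ∑ k ∈ Finset.Icc 1 N, I k s))
    (hA0 : ∀ k ∈ Finset.Icc 1 N, ∀ s, 0 ≤ A k s) (hAm : ∀ k ∈ Finset.Icc 1 N, Measurable (A k))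
    (hD : ∀ k ∈ Finset.Icc 1 N, Integrable (D k) P)
    (hI : ∀ k ∈ Finset.Icc 1 N, Integrable (I k) P ∧ ∫ s, I k s ∂P = 0) :
    (∀ k ∈ Finset.Icc 1 N, Integrable (A k) P) ∧
      ∑ k ∈ Finset.Icc 1 N, ∫ s, A k s ∂P ≤ K + d * ∑ k ∈ Finset.Icc 1 N, ∫ s, D k s ∂P := by
  have hsI : Integrable (fun s => ∑ k ∈ Finset.Icc 1 N, I k s) P :=
    integrable_finsetSum _ fun k hk => (hI k hk).1
  have hsD : Integrable (fun s => ∑ k ∈ Finset.Icc 1 N, D k s) P :=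
    integrable_finsetSum _ hD
  have hr : Integrable (fun s => d * ∑ k ∈ Finset.Icc 1 N, D k s -
      ∑ k ∈ Finset.Icc 1 N, I k s) P := (hsD.const_mul d).sub hsI
  have hr' : Integrable (fun s => K + (d * ∑ k ∈ Finset.Icc 1 N, D k s -
      ∑ k ∈ Finset.Icc 1 N, I k s)) P := (integrable_const K).add hr
  have hAint : ∀ k ∈ Finset.Icc 1 N, Integrable (A k) P := fun k hk => by
    refine hr'.mono' (hAm k hk).aestronglyMeasurable (Filter.Eventually.of_forall fun s => ?_)
    rw [Real.norm_of_nonneg (hA0 k hk s)]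
    exact (Finset.single_le_sum (f := fun k => A k s) (fun j hj => hA0 j hj s) hk).trans (hle s)
  refine ⟨hAint, ?_⟩
  have hfin := integral_mono (integrable_finsetSum _ hAint) hr' hle
  rw [integral_finsetSum _ hAint, integral_add (integrable_const _) hr,
    integral_sub (hsD.const_mul d) hsI, integral_const_mul, integral_finsetSum _ hD,
    integral_finsetSum _ fun k hk => (hI k hk).1,
    Finset.sum_eq_zero fun k hk => (hI k hk).2] at hfin
  simpa using hfin

end Telescoping

section RandomIndex
variable {n : ℕ} {Ξ Ω : Type*} [MeasurableSpace Ξ] [MeasurableSpace Ω] {P : Measure Ω}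
  [IsProbabilityMeasure P] {α L : ℝ} {γ : ℕ → ℝ} {N : ℕ} {R : Ω → ℕ} {ξ : ℕ → ℕ → Ω → Ξ}
  {v : ℕ → ℕ → Ω → Vec n}

/-- Every weight equals `α²/(2L) - α²/(4L) = α²/(4L)`. -/
lemma stopProb_eq (hα : 0 < α) (hL : 0 < L) (hγ : ∀ k ∈ Finset.Icc 1 N, γ k = α / (2 * L))
    {k : ℕ} (hk : k ∈ Finset.Icc 1 N) : stopProb α L γ N k = 1 / N := by
  have h1 : ∀ j ∈ Finset.Icc 1 N, α * γ j - L * γ j ^ 2 = α ^ 2 / (4 * L) := fun j hj => by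
    rw [hγ j hj]; field_simp; ring
  have h0 : α ^ 2 / (4 * L) ≠ 0 := by positivity
  rw [stopProb, Finset.sum_congr rfl h1, h1 k hk]
  simp only [Finset.sum_const, Nat.card_Icc, Nat.add_sub_cancel, nsmul_eq_mul]
  rw [div_mul_cancel_right₀ h0, one_div]

variable (hs : IsSampling P α L γ N ξ v R) (hα : 0 < α) (hL : 0 < L) (hN : 1 ≤ N)
  (hγ : ∀ k ∈ Finset.Icc 1 N, γ k = α / (2 * L))
include hs hα hL hN hγ

/-- The law of `R` is prescribed only on `1, …, N`, but those probabilities already sum to one. -/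
lemma IsSampling.index_mem_ae : ∀ᵐ s ∂P, R s ∈ Finset.Icc 1 N := by
  have hmeas : ∀ k, MeasurableSet {s | R s = k} := fun k =>
    hs.measurable_index (measurableSet_singleton k)
  have e : {s | R s ∈ Finset.Icc 1 N} = ⋃ k ∈ Finset.Icc 1 N, {s | R s = k} := by
    ext s; simp
  have h1 : P {s | R s ∈ Finset.Icc 1 N} = 1 := by
    rw [e, measure_biUnion_finset _ fun k _ => hmeas k]
    · rw [Finset.sum_congr rfl fun k hk => by rw [hs.law_index k hk, stopProb_eq hα hL hγ hk]]
      simp only [Finset.sum_const, Nat.card_Icc, Nat.add_sub_cancel, nsmul_eq_mul]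
      rw [ENNReal.ofReal_div_of_pos (by positivity), ENNReal.ofReal_one, ENNReal.ofReal_natCast]
      exact ENNReal.mul_div_cancel (by positivity) (by simp)
    · intro j _ k _ hjk
      exact Set.disjoint_left.2 fun s hj hk => hjk (hj.symm.trans hk)
  have h2 : MeasurableSet {s | R s ∈ Finset.Icc 1 N} :=
    hs.measurable_index (MeasurableSet.of_discrete (s := {k | k ∈ Finset.Icc 1 N}))
  exact (mem_ae_iff_prob_eq_one h2).2 h1

/-- Sampling an independent uniform index averages the expectations. -/
lemma IsSampling.integral_index {Y : ℕ → Ω → ℝ}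
    (hYm : ∀ k ∈ Finset.Icc 1 N, Measurable[sampleSigma ξ v Set.univ] (Y k))
    (hYi : ∀ k ∈ Finset.Icc 1 N, Integrable (Y k) P) :
    Integrable (fun s => Y (R s) s) P ∧
      ∫ s, Y (R s) s ∂P = (1 / N) * ∑ k ∈ Finset.Icc 1 N, ∫ s, Y k s ∂P := by
  have hmeas : ∀ k, MeasurableSet {s | R s = k} := fun k =>
    hs.measurable_index (measurableSet_singleton k)
  have hae : (fun s => Y (R s) s) =ᵐ[P]
      fun s => ∑ k ∈ Finset.Icc 1 N, {s | R s = k}.indicator (Y k) s := by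
    filter_upwards [hs.index_mem_ae hα hL hN hγ] with s hR
    rw [Finset.sum_eq_single (R s)]
    · simp
    · intro k _ hk
      exact Set.indicator_of_notMem (fun h => hk h.symm) _
    · exact fun h => absurd hR h
  have hind : ∀ k ∈ Finset.Icc 1 N, Integrable ({s | R s = k}.indicator (Y k)) P := fun k hk =>
    (hYi k hk).indicator (hmeas k)
  refine ⟨(integrable_finsetSum _ hind).congr hae.symm, ?_⟩
  rw [integral_congr_ae hae, integral_finsetSum _ hind, Finset.mul_sum]
  refine Finset.sum_congr rfl fun k hk => ?_
  have hc : Measurable (fun r : ℕ => if r = k then (1 : ℝ) else 0) := measurable_from_top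
  -- Measurability of `Y k` in the samples makes it independent of the event `R = k`, whose
  -- probability `1/N` factors out.
  have hI : IndepFun (Y k) (fun s => if R s = k then (1 : ℝ) else 0) P :=
    (hs.indepFun_index (hYm k hk)).comp measurable_id hc
  have e : {s | R s = k}.indicator (Y k) =
      fun s => Y k s * (if R s = k then (1 : ℝ) else 0) := by
    ext s; simp [Set.indicator_apply]
  have e2 : (fun s => if R s = k then (1 : ℝ) else 0) = {s | R s = k}.indicator 1 := by
    ext s; simp [Set.indicator_apply]
  rw [e, hI.integral_fun_mul_eq_mul_integral (hYi k hk).aestronglyMeasurable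
    (hc.comp hs.measurable_index).aestronglyMeasurable, e2, integral_indicator_one (hmeas k),
    Measure.real, hs.law_index k hk, stopProb_eq hα hL hγ hk,
    ENNReal.toReal_ofReal (by positivity), mul_comm]

end RandomIndex

end

-- The run of the algorithm and the three bounds.

section

section Algorithm
variable {n : ℕ} {Ξ Ω : Type*} [MeasurableSpace Ξ] [MeasurableSpace Ω]
    {P : Measure Ω} [IsProbabilityMeasure P] {X : Set (Vec n)} (hX_closed : IsClosed X)
    (hX : Convex ℝ X) {f h : Vec n → ℝ} (hh : ConvexOn ℝ X h) (hΨ : BddBelow (Psi f h '' X))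
    {α : ℝ} (hα : 0 < α) {w : Vec n → ℝ} {dw : Vec n → Vec n}
    (hw : IsDistanceGenerating X α w dw)
    (hproj : ∀ x ∈ X, ∀ (g : Vec n) (c : ℝ), 0 < c → ∃ u, IsGenProj X w dw h x g c u)
    {F : Vec n → Ξ → ℝ} (hF : Measurable (Function.uncurry F))
    {L : ℝ} (hL : 0 < L) {σ M : ℝ} (hM : ∀ x ∈ X, ‖∇ f x‖ ≤ M)
    {μ : ℝ} (hμ : 0 < μ) {x₁ : Vec n} (hx₁ : x₁ ∈ X)
    {N : ℕ} (hN : 1 ≤ N) {m : ℕ} (hm : 1 ≤ m)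
    {γ : ℕ → ℝ} (hγ : ∀ k ∈ Finset.Icc 1 N, γ k = α / (2 * L))
    {batch : ℕ → ℕ} (hbatch : ∀ k ∈ Finset.Icc 1 N, batch k = m)
    {ξ : ℕ → ℕ → Ω → Ξ} {v : ℕ → ℕ → Ω → Vec n} {R : Ω → ℕ}
    (hsamp : IsSampling P α L γ N ξ v R)
    (horacle : ∀ k i, IsOracle X f F L σ (P.map (ξ k i)))
    {x : ℕ → Ω → Vec n}
    (hx : x = fun k s => iterate X w dw h F μ γ batch x₁
      (fun j i => ξ j i s) (fun j i => v j i s) k)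
    {G : ℕ → Ω → Vec n}
    (hG : G = fun k s => batchEst F μ (batch k) (x k s) (fun i => ξ k i s) (fun i => v k i s))

lemma measurable_projGrad {Ω : Type*} [MeasurableSpace Ω] (hw : IsDistanceGenerating X α w dw)
    (hX : Convex ℝ X) (hα : 0 < α) (hh : ConvexOn ℝ X h)
    (hproj : ∀ x ∈ X, ∀ (g : Vec n) (c : ℝ), 0 < c → ∃ u, IsGenProj X w dw h x g c u)
    {c : ℝ} (hc : 0 < c) {u g : Ω → Vec n} (hu : Measurable u) (hg : Measurable g)
    (huX : ∀ s, u s ∈ X) : Measurable fun s => projGrad X w dw h (u s) (g s) c :=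
  (hu.sub (measurable_genProj hw hX hα hh hproj hc hu hg huX)).const_smul (1 / c)

lemma measurable_norm_projGrad_sq {Ω : Type*} [MeasurableSpace Ω]
    (hw : IsDistanceGenerating X α w dw) (hX : Convex ℝ X) (hα : 0 < α) (hh : ConvexOn ℝ X h)
    (hproj : ∀ x ∈ X, ∀ (g : Vec n) (c : ℝ), 0 < c → ∃ u, IsGenProj X w dw h x g c u)
    {c : ℝ} (hc : 0 < c) {u g : Ω → Vec n} (hu : Measurable u) (hg : Measurable g)
    (huX : ∀ s, u s ∈ X) : Measurable fun s => ‖projGrad X w dw h (u s) (g s) c‖ ^ 2 :=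
  (measurable_projGrad hw hX hα hh hproj hc hu hg huX).norm.pow_const 2

include hα hL hγ in
lemma stepsize_pos : ∀ k ∈ Finset.Icc 1 N, 0 < γ k := fun k hk => by
  rw [hγ k hk]; positivity

omit [MeasurableSpace Ξ] [MeasurableSpace Ω] in
include hproj hα hL hγ hx₁ hx in
lemma run_mem {k : ℕ} (hk : k ≤ N + 1) (s : Ω) : x k s ∈ X := by
  rw [hx]
  exact iterate_mem hproj (stepsize_pos hα hL hγ) hx₁ _ _ hk

omit [MeasurableSpace Ξ] [MeasurableSpace Ω] in
include hx in
lemma run_one (s : Ω) : x 1 s = x₁ := by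
  rw [hx]; simp only [iterate]

omit [MeasurableSpace Ξ] [MeasurableSpace Ω] in
include hx hG in
lemma run_succ {k : ℕ} (hk : 1 ≤ k) (s : Ω) :
    x (k + 1) s = genProj X w dw h (x k s) (G k s) (γ k) := by
  rw [hG, hx]
  exact iterate_succ_eq _ _ hk

include hF hx₁ hsamp horacle in
lemma run_isC11 : IsC11 L f := by
  have : IsProbabilityMeasure (P.map (ξ 0 0)) :=
    Measure.isProbabilityMeasure_map (hsamp.measurable_noise 0 0).aemeasurable
  exact (horacle 0 0).isC11 hF hx₁

omit [IsProbabilityMeasure P] [MeasurableSpace Ξ] [MeasurableSpace Ω] in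
include hbatch hG in
lemma run_error_eq {k : ℕ} (hk : k ∈ Finset.Icc 1 N) :
    (fun s => G k s - smoothedGradient μ f (x k s)) = fun s =>
      batchEst F μ m (x k s) (fun i => ξ k i s) (fun i => v k i s) -
        smoothedGradient μ f (x k s) := by
  rw [hG]; simp only [hbatch k hk]

include hw hX hα hh hproj hF hL hγ hx₁ hx

omit [MeasurableSpace Ω] in
lemma measurable_run {k : ℕ} (hk : k ≤ N + 1) :
    Measurable[sampleSigma ξ v {p | p.1 < k}] (x k) := by
  rw [hx]
  exact @measurable_iterate n Ξ Ω X F μ α w dw h γ N batch x₁ _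
    (sampleSigma ξ v {p | p.1 < k}) hw hX hα hh hproj hF (stepsize_pos hα hL hγ) hx₁ ξ v k hk
    (fun j hj i => (measurable_sampleSigma (by simpa using hj)).1)
    (fun j hj i => (measurable_sampleSigma (by simpa using hj)).2)

omit [MeasurableSpace Ω] in
-- The σ-algebra of all samples suffices here: it is what independence from `R` requires.
lemma measurable_comp_run {k : ℕ} (hk : k ≤ N + 1) :
    Measurable[sampleSigma ξ v Set.univ] (fun s => h (x k s)) := by
  rw [hx]
  exact @measurable_comp_iterate n Ξ Ω X F μ α w dw h γ N batch x₁ _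
    (sampleSigma ξ v Set.univ) hw hX hα hh hproj hF (stepsize_pos hα hL hγ) hx₁ ξ v k hk
    (fun j hj i => (measurable_sampleSigma (Set.mem_univ _)).1)
    (fun j hj i => (measurable_sampleSigma (Set.mem_univ _)).2)

omit [MeasurableSpace Ω] in
include hG in
lemma measurable_run_estimate {k : ℕ} (hk : k ≤ N + 1) :
    Measurable[sampleSigma ξ v Set.univ] (G k) := by
  rw [hG]
  have h1 := (measurable_run hX hh hα hw hproj hF hL hx₁ hγ hx hk (ξ := ξ) (v := v)).mono
    (sampleSigma_mono (Set.subset_univ _)) le_rfl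
  exact @measurable_batchEst n Ξ Ω F μ _ (sampleSigma ξ v Set.univ) hF (batch k) (x k) (ξ k) (v k)
    h1 (fun i _ => (measurable_sampleSigma (Set.mem_univ _)).1)
    (fun i _ => (measurable_sampleSigma (Set.mem_univ _)).2)

include hX_closed hM hμ hm hbatch hsamp horacle hG

lemma run_error_sq {k : ℕ} (hk : k ∈ Finset.Icc 1 N) :
    Integrable (fun s => ‖G k s - smoothedGradient μ f (x k s)‖ ^ 2) P ∧
      ∫ s, ‖G k s - smoothedGradient μ f (x k s)‖ ^ 2 ∂P ≤ sigmaTildeSq n M σ μ L / m := by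
  have hk' : k ≤ N + 1 := by have := (Finset.mem_Icc.1 hk).2; omega
  exact integrable_norm_stepError_sq hsamp horacle hF hμ.ne' hX_closed hM
    (run_isC11 hF hx₁ hsamp horacle) hm
    (measurable_run hX hh hα hw hproj hF hL hx₁ hγ hx hk')
    (run_mem hα hproj hL hx₁ hγ hx hk')
    (run_error_eq hbatch hG hk)

lemma run_error_inner {k : ℕ} (hk : k ∈ Finset.Icc 1 N) {φ : Ω → Vec n}
    (hφ : Measurable[sampleSigma ξ v {p | p.1 < k}] φ)
    (hφ2 : Integrable (fun s => ‖φ s‖ ^ 2) P) :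
    Integrable (fun s => inner ℝ (G k s - smoothedGradient μ f (x k s)) (φ s)) P ∧
      ∫ s, inner ℝ (G k s - smoothedGradient μ f (x k s)) (φ s) ∂P = 0 := by
  have hk' : k ≤ N + 1 := by have := (Finset.mem_Icc.1 hk).2; omega
  exact integral_inner_stepError hsamp horacle hF hμ.ne' hX_closed hM
    (run_isC11 hF hx₁ hsamp horacle) hm
    (measurable_run hX hh hα hw hproj hF hL hx₁ hγ hx hk')
    (run_mem hα hproj hL hx₁ hγ hx hk')
    (run_error_eq hbatch hG hk)
    hφ hφ2

include hΨ in
/-- The expected squared projected gradients of the run, summed over the steps. -/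
lemma sum_integral_norm_projGrad_sq_le :
    (∀ k ∈ Finset.Icc 1 N,
      Integrable (fun s => ‖projGrad X w dw h (x k s) (G k s) (γ k)‖ ^ 2) P) ∧
      α ^ 2 / (4 * L) * ∑ k ∈ Finset.Icc 1 N,
        ∫ s, ‖projGrad X w dw h (x k s) (G k s) (γ k)‖ ^ 2 ∂P ≤
        L * DPsi X f h L x₁ ^ 2 + μ ^ 2 * L * n +
          N * (sigmaTildeSq n M σ μ L / m) / (2 * L) := by
  have hf := run_isC11 hF hx₁ hsamp horacle
  obtain ⟨hfμ, hgrad⟩ := hf.smoothing (μ := μ)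
  have hsm := measurable_smoothedGradient (μ := μ) hf
  have hγ0 := stepsize_pos hα hL hγ
  have hle : ∀ k ∈ Finset.Icc 1 N, k ≤ N + 1 := fun k hk => by
    have := (Finset.mem_Icc.1 hk).2; omega
  have hmem := fun k (hk : k ≤ N + 1) => run_mem hα hproj hL hx₁ hγ hx hk
  have hrun := fun k (hk : k ≤ N + 1) =>
    measurable_run (ξ := ξ) (v := v) hX hh hα hw hproj hF hL hx₁ hγ hx hk
  have herr := fun k (hk : k ∈ Finset.Icc 1 N) =>
    run_error_sq hX_closed hX hh hα hw hproj hF hL hM hμ hx₁ hm hγ hbatch hsamp horacle hx hG hk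
  have hqm : ∀ k ∈ Finset.Icc 1 N, Measurable[sampleSigma ξ v {p | p.1 < k}]
      fun s => projGrad X w dw h (x k s) (smoothedGradient μ f (x k s)) (γ k) := fun k hk =>
    @measurable_projGrad n X h α w dw Ω (sampleSigma ξ v {p | p.1 < k}) hw hX hα hh hproj _
      (hγ0 k hk) _ _ (hrun k (hle k hk)) (hsm.comp (hrun k (hle k hk))) (hmem k (hle k hk))
  have hxm := fun k (hk : k ≤ N + 1) => (hrun k hk).mono (hsamp.sampleSigma_le _) le_rfl
  have hGm := fun k (hk : k ≤ N + 1) => (measurable_run_estimate (ξ := ξ) (v := v) hX hh hα hw hproj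
    hF hL hx₁ hγ hx hG hk).mono (hsamp.sampleSigma_le _) le_rfl
  have hclose : ∀ y, |smoothing μ f y - f y| ≤ L / 2 * (μ ^ 2 * n) :=
    fun y => hf.abs_smoothing_sub_le y
  have hinf : ∀ y ∈ X, sInf (Psi f h '' X) ≤ Psi f h y := fun y hy =>
    csInf_le hΨ (Set.mem_image_of_mem _ hy)
  have hlo : ∀ y ∈ X, sInf (Psi f h '' X) - L / 2 * (μ ^ 2 * n) ≤ Psi (smoothing μ f) h y :=
    fun y hy => by
      have h1 := hinf y hy
      have h2 := (abs_le.1 (hclose y)).1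
      simp only [Psi] at h1 ⊢
      linarith
  -- The potential is `Ψ_μ(x_k)`; `A` uses the sampled and `B` the smoothed gradient. Replacing
  -- `f_μ` by `f` at the two ends costs `Lμ²n/2` each time.
  have hmain := sum_integral_le_of_descent (P := P) (N := N) (c := α ^ 2 / (4 * L))
    (d := 1 / (2 * L)) (γ := α / (2 * L)) (lo := sInf (Psi f h '' X) - L / 2 * (μ ^ 2 * n))
    (K := Psi f h x₁ + L / 2 * (μ ^ 2 * n)) (by positivity)
    (A := fun k s => ‖projGrad X w dw h (x k s) (G k s) (γ k)‖ ^ 2)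
    (B := fun k s => ‖projGrad X w dw h (x k s) (smoothedGradient μ f (x k s)) (γ k)‖ ^ 2)
    (D := fun k s => ‖G k s - smoothedGradient μ f (x k s)‖ ^ 2)
    (I := fun k s => inner ℝ (G k s - smoothedGradient μ f (x k s))
      (projGrad X w dw h (x k s) (smoothedGradient μ f (x k s)) (γ k)))
    (Φ := fun k s => Psi (smoothing μ f) h (x k s))
    (fun k hk s => by
      have := descent_step hw hX hα hh hproj hL hfμ (hmem k (hle k hk) s) (hγ k hk) (G k s)
      rw [hgrad] at this
      rw [run_succ hx hG (Finset.mem_Icc.1 hk).1, ← hγ k hk]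
      exact this)
    (fun k hk s => by
      -- The same inequality with no noise: at `g = ∇f_μ(x_k)` it bounds the test vector of step `k`
      -- by the current potential.
      have := descent_step hw hX hα hh hproj hL hfμ (hmem k (hle k hk) s) (hγ k hk)
        (smoothedGradient μ f (x k s))
      rw [hgrad, sub_self, inner_zero_left, norm_zero] at this
      have h2 := hlo _ (isGenProj_genProj (hproj _ (hmem k (hle k hk) s)
        (smoothedGradient μ f (x k s)) _ (hγ0 k hk))).1
      linarith)
    (fun s => hlo _ (hmem _ le_rfl s))
    (fun s => by
      have h2 := (abs_le.1 (hclose x₁)).2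
      simp only [run_one hx, Psi]
      linarith)
    (fun k s => by positivity) (fun k s => by positivity)
    (fun k hk => (measurable_projGrad hw hX hα hh hproj (hγ0 k hk) (hxm k (hle k hk))
      (hGm k (hle k hk)) (hmem k (hle k hk))).norm.pow_const 2)
    (fun k hk => ((hqm k hk).mono (hsamp.sampleSigma_le _) le_rfl).norm.pow_const 2)
    (fun k hk => (herr k hk).1)
    (fun k hk hB => run_error_inner hX_closed hX hh hα hw hproj hF hL hM hμ hx₁ hm hγ hbatch hsamp
      horacle hx hG hk (hqm k hk) hB)
  refine ⟨fun k hk => (hmain.1 k hk).1, hmain.2.trans ?_⟩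
  have hD : L * DPsi X f h L x₁ ^ 2 = Psi f h x₁ - sInf (Psi f h '' X) := by
    rw [DPsi, Real.sq_sqrt (div_nonneg (sub_nonneg.2 (hinf x₁ hx₁)) hL.le)]
    field_simp
  have hS : ∑ k ∈ Finset.Icc 1 N, ∫ s, ‖G k s - smoothedGradient μ f (x k s)‖ ^ 2 ∂P ≤
      N * (sigmaTildeSq n M σ μ L / m) := by
    refine (Finset.sum_le_card_nsmul _ _ _ fun k hk => (herr k hk).2).trans_eq ?_
    simp
  have hS' : 1 / (2 * L) * ∑ k ∈ Finset.Icc 1 N,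
      ∫ s, ‖G k s - smoothedGradient μ f (x k s)‖ ^ 2 ∂P ≤
      1 / (2 * L) * (N * (sigmaTildeSq n M σ μ L / m)) := by gcongr
  rw [hD]
  have e : N * (sigmaTildeSq n M σ μ L / m) / (2 * L) =
      1 / (2 * L) * (N * (sigmaTildeSq n M σ μ L / m)) := by ring
  rw [e]
  linarith

include hN

include hΨ in
theorem integral_norm_randomized_projGrad_sq_le :
    Integrable (fun s => ‖projGrad X w dw h (x (R s) s) (G (R s) s) (γ (R s))‖ ^ 2) P ∧
      ∫ s, ‖projGrad X w dw h (x (R s) s) (G (R s) s) (γ (R s))‖ ^ 2 ∂P ≤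
        (4 * L ^ 2 * DPsi X f h L x₁ ^ 2 + 4 * μ ^ 2 * L ^ 2 * n) / (α ^ 2 * N)
          + 2 * sigmaTildeSq n M σ μ L / (α ^ 2 * m) := by
  obtain ⟨h1, h2⟩ := sum_integral_norm_projGrad_sq_le hX_closed hX hh hΨ hα hw hproj hF hL hM hμ hx₁
    hm hγ hbatch hsamp horacle hx hG
  have hγ0 := stepsize_pos hα hL hγ
  have hle : ∀ k ∈ Finset.Icc 1 N, k ≤ N + 1 := fun k hk => by
    have := (Finset.mem_Icc.1 hk).2; omega
  obtain ⟨h3, h4⟩ := hsamp.integral_index hα hL hN hγ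
    (Y := fun k s => ‖projGrad X w dw h (x k s) (G k s) (γ k)‖ ^ 2)
    (fun k hk => @measurable_norm_projGrad_sq n X h α w dw Ω (sampleSigma ξ v Set.univ) hw hX hα hh hproj _
      (hγ0 k hk) _ _
      ((measurable_run hX hh hα hw hproj hF hL hx₁ hγ hx (hle k hk)).mono
        (sampleSigma_mono (Set.subset_univ _)) le_rfl)
      (measurable_run_estimate hX hh hα hw hproj hF hL hx₁ hγ hx hG (hle k hk))
      (run_mem hα hproj hL hx₁ hγ hx (hle k hk))) h1
  refine ⟨h3, ?_⟩
  rw [h4]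
  have hN0 : (0 : ℝ) < N := by exact_mod_cast hN
  have hm0 : (0 : ℝ) < m := by exact_mod_cast hm
  -- This factor undoes the coefficient `α²/(4L)` and supplies the weight `1/N` of the uniform
  -- index.
  have h5 := mul_le_mul_of_nonneg_left h2 (by positivity : 0 ≤ 4 * L / (α ^ 2 * N))
  refine (le_of_eq ?_).trans (h5.trans_eq ?_)
  · field_simp
  · field_simp
    ring

include hΨ in
theorem integral_norm_randomized_exact_projGrad_sq_le :
    Integrable (fun s => ‖projGrad X w dw h (x (R s) s) (∇ f (x (R s) s)) (γ (R s))‖ ^ 2) P ∧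
      ∫ s, ‖projGrad X w dw h (x (R s) s) (∇ f (x (R s) s)) (γ (R s))‖ ^ 2 ∂P ≤
        μ ^ 2 * L ^ 2 * ((n : ℝ) + 3) ^ 2 / (2 * α ^ 2)
          + (16 * L ^ 2 * DPsi X f h L x₁ ^ 2 + 16 * μ ^ 2 * L ^ 2 * n) / (α ^ 2 * N)
          + 12 * sigmaTildeSq n M σ μ L / (α ^ 2 * m) := by
  obtain ⟨h1, h2⟩ := sum_integral_norm_projGrad_sq_le hX_closed hX hh hΨ hα hw hproj hF hL hM hμ hx₁
    hm hγ hbatch hsamp horacle hx hG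
  have hf := run_isC11 hF hx₁ hsamp horacle
  have hγ0 := stepsize_pos hα hL hγ
  have hle : ∀ k ∈ Finset.Icc 1 N, k ≤ N + 1 := fun k hk => by
    have := (Finset.mem_Icc.1 hk).2; omega
  have herr := fun k (hk : k ∈ Finset.Icc 1 N) =>
    run_error_sq hX_closed hX hh hα hw hproj hF hL hM hμ hx₁ hm hγ hbatch hsamp horacle hx hG hk
  have hYm : ∀ k ∈ Finset.Icc 1 N, Measurable[sampleSigma ξ v Set.univ]
      fun s => ‖projGrad X w dw h (x k s) (∇ f (x k s)) (γ k)‖ ^ 2 := fun k hk => by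
    have hr : Measurable[sampleSigma ξ v Set.univ] (x k) :=
      (measurable_run hX hh hα hw hproj hF hL hx₁ hγ hx (hle k hk)).mono
        (sampleSigma_mono (Set.subset_univ _)) le_rfl
    exact @measurable_norm_projGrad_sq n X h α w dw Ω (sampleSigma ξ v Set.univ) hw hX hα hh hproj _
      (hγ0 k hk) _ _ hr (hf.continuous_gradient.measurable.comp hr)
      (run_mem hα hproj hL hx₁ hγ hx (hle k hk))
  -- The exact projected gradient is compared with the sampled one through that of `∇f_μ`, each
  -- passage using `‖a + b‖² ≤ 2‖a‖² + 2‖b‖²`. The resulting factor 4 turns the `2σ̃²` of the first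
  -- bound into `8σ̃²`, and the direct error adds `4σ̃²`.
  have hpt : ∀ k ∈ Finset.Icc 1 N, ∀ s, ‖projGrad X w dw h (x k s) (∇ f (x k s)) (γ k)‖ ^ 2 ≤
      2 * (L ^ 2 * μ ^ 2 * n) / α ^ 2 + 4 * ‖projGrad X w dw h (x k s) (G k s) (γ k)‖ ^ 2 +
        4 / α ^ 2 * ‖G k s - smoothedGradient μ f (x k s)‖ ^ 2 := fun k hk s => by
    have hxk := run_mem hα hproj hL hx₁ hγ hx (hle k hk) s
    have h3 := norm_projGrad_sub_le hw hX hα hh hproj hxk (hγ0 k hk) (g := ∇ f (x k s))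
      (g' := smoothedGradient μ f (x k s))
    have h4 := norm_projGrad_sub_le hw hX hα hh hproj hxk (hγ0 k hk)
      (g := smoothedGradient μ f (x k s)) (g' := G k s)
    have h5 := hf.norm_smoothedGradient_sub_sq_le (μ := μ) (x k s)
    rw [norm_sub_rev] at h5
    rw [norm_sub_rev (smoothedGradient μ f (x k s)) (G k s)] at h4
    set p := projGrad X w dw h (x k s) (∇ f (x k s)) (γ k)
    set q := projGrad X w dw h (x k s) (smoothedGradient μ f (x k s)) (γ k)
    set r := projGrad X w dw h (x k s) (G k s) (γ k)
    have h6 : ‖p - q‖ ^ 2 ≤ L ^ 2 * μ ^ 2 * n / α ^ 2 := by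
      calc ‖p - q‖ ^ 2 ≤ (‖∇ f (x k s) - smoothedGradient μ f (x k s)‖ / α) ^ 2 := by gcongr
        _ ≤ _ := by rw [div_pow]; gcongr
    have h7 : ‖q - r‖ ^ 2 ≤ ‖G k s - smoothedGradient μ f (x k s)‖ ^ 2 / α ^ 2 := by
      rw [← div_pow]; gcongr
    have h8 : ‖p‖ ^ 2 ≤ 2 * ‖p - q‖ ^ 2 + 2 * ‖q‖ ^ 2 := by
      have := norm_le_norm_sub_add p q
      nlinarith [sq_nonneg (‖p - q‖ - ‖q‖), norm_nonneg p]
    have h9 : ‖q‖ ^ 2 ≤ 2 * ‖q - r‖ ^ 2 + 2 * ‖r‖ ^ 2 := by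
      have := norm_le_norm_sub_add q r
      nlinarith [sq_nonneg (‖q - r‖ - ‖r‖), norm_nonneg q]
    have e1 : 2 * (L ^ 2 * μ ^ 2 * n) / α ^ 2 = 2 * (L ^ 2 * μ ^ 2 * n / α ^ 2) := by ring
    have e2 : 4 / α ^ 2 * ‖G k s - smoothedGradient μ f (x k s)‖ ^ 2 =
        4 * (‖G k s - smoothedGradient μ f (x k s)‖ ^ 2 / α ^ 2) := by ring
    rw [e1, e2]
    linarith
  have hbi : ∀ k ∈ Finset.Icc 1 N, Integrable (fun s => 2 * (L ^ 2 * μ ^ 2 * n) / α ^ 2 +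
      4 * ‖projGrad X w dw h (x k s) (G k s) (γ k)‖ ^ 2) P := fun k hk =>
    (integrable_const _).add ((h1 k hk).const_mul 4)
  have hbi' : ∀ k ∈ Finset.Icc 1 N, Integrable (fun s => 2 * (L ^ 2 * μ ^ 2 * n) / α ^ 2 +
      4 * ‖projGrad X w dw h (x k s) (G k s) (γ k)‖ ^ 2 +
      4 / α ^ 2 * ‖G k s - smoothedGradient μ f (x k s)‖ ^ 2) P := fun k hk =>
    (hbi k hk).add ((herr k hk).1.const_mul _)
  have hYi : ∀ k ∈ Finset.Icc 1 N, Integrable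
      (fun s => ‖projGrad X w dw h (x k s) (∇ f (x k s)) (γ k)‖ ^ 2) P := fun k hk => by
    refine (hbi' k hk).mono'
      ((hYm k hk).mono (hsamp.sampleSigma_le _) le_rfl).aestronglyMeasurable
      (Filter.Eventually.of_forall fun s => ?_)
    rw [Real.norm_of_nonneg (by positivity)]
    exact hpt k hk s
  obtain ⟨h3, h4⟩ := hsamp.integral_index hα hL hN hγ
    (Y := fun k s => ‖projGrad X w dw h (x k s) (∇ f (x k s)) (γ k)‖ ^ 2) hYm hYi
  refine ⟨h3, ?_⟩
  rw [h4]
  have hN0 : (0 : ℝ) < N := by exact_mod_cast hN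
  have hm0 : (0 : ℝ) < m := by exact_mod_cast hm
  have h5 : ∀ k ∈ Finset.Icc 1 N,
      ∫ s, ‖projGrad X w dw h (x k s) (∇ f (x k s)) (γ k)‖ ^ 2 ∂P ≤
      2 * (L ^ 2 * μ ^ 2 * n) / α ^ 2 + 4 / α ^ 2 * (sigmaTildeSq n M σ μ L / m) +
        4 * ∫ s, ‖projGrad X w dw h (x k s) (G k s) (γ k)‖ ^ 2 ∂P := fun k hk => by
    have h6 := integral_mono (hYi k hk) (hbi' k hk) (hpt k hk)
    rw [integral_add (hbi k hk) ((herr k hk).1.const_mul _),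
      integral_add (integrable_const _) ((h1 k hk).const_mul 4), integral_const_mul,
      integral_const_mul] at h6
    have h7 : 4 / α ^ 2 * ∫ s, ‖G k s - smoothedGradient μ f (x k s)‖ ^ 2 ∂P ≤
        4 / α ^ 2 * (sigmaTildeSq n M σ μ L / m) := by
      gcongr; exact (herr k hk).2
    simp only [integral_const, probReal_univ, one_smul] at h6
    linarith
  have h6 := Finset.sum_le_sum h5
  rw [Finset.sum_add_distrib, ← Finset.mul_sum, Finset.sum_const, Nat.card_Icc,
    Nat.add_sub_cancel, nsmul_eq_mul] at h6
  have h7 := mul_le_mul_of_nonneg_left h2 (by positivity : 0 ≤ 16 * L / (α ^ 2 * N))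
  have h8 := mul_le_mul_of_nonneg_left h6 (by positivity : 0 ≤ 1 / (N : ℝ))
  have h9 : 2 * (L ^ 2 * μ ^ 2 * n) / α ^ 2 ≤
      μ ^ 2 * L ^ 2 * ((n : ℝ) + 3) ^ 2 / (2 * α ^ 2) := by
    have e : 2 * (L ^ 2 * μ ^ 2 * n) / α ^ 2 = μ ^ 2 * L ^ 2 * (4 * n) / (2 * α ^ 2) := by
      field_simp; ring
    rw [e]
    -- The smoothing bias `L²μ²n` is sharper than required, since `(n + 3)² - 4n = n² + 2n + 9`.
    have : (4 * n : ℝ) ≤ (n + 3) ^ 2 := by nlinarith [sq_nonneg (n : ℝ)]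
    gcongr
  have e1 : 16 * L / (α ^ 2 * N) * (α ^ 2 / (4 * L) * ∑ k ∈ Finset.Icc 1 N,
      ∫ s, ‖projGrad X w dw h (x k s) (G k s) (γ k)‖ ^ 2 ∂P) = 1 / (N : ℝ) *
      (4 * ∑ k ∈ Finset.Icc 1 N,
      ∫ s, ‖projGrad X w dw h (x k s) (G k s) (γ k)‖ ^ 2 ∂P) := by
    field_simp; ring
  have e2 : 16 * L / (α ^ 2 * N) * (L * DPsi X f h L x₁ ^ 2 + μ ^ 2 * L * n +
      N * (sigmaTildeSq n M σ μ L / m) / (2 * L)) =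
      (16 * L ^ 2 * DPsi X f h L x₁ ^ 2 + 16 * μ ^ 2 * L ^ 2 * n) / (α ^ 2 * N) +
      8 * sigmaTildeSq n M σ μ L / (α ^ 2 * m) := by
    field_simp; ring
  have e3 : 1 / (N : ℝ) * (N * (2 * (L ^ 2 * μ ^ 2 * n) / α ^ 2 +
      4 / α ^ 2 * (sigmaTildeSq n M σ μ L / m))) = 2 * (L ^ 2 * μ ^ 2 * n) / α ^ 2 +
      4 * sigmaTildeSq n M σ μ L / (α ^ 2 * m) := by
    field_simp
  have e4 : 12 * sigmaTildeSq n M σ μ L / (α ^ 2 * m) =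
      8 * sigmaTildeSq n M σ μ L / (α ^ 2 * m) + 4 * sigmaTildeSq n M σ μ L / (α ^ 2 * m) := by
    ring
  rw [mul_add, e3] at h8
  rw [e1, e2] at h7
  rw [e4]
  linarith

include hΨ in
theorem integral_randomized_objective_gap_le (hc : ConvexOn ℝ Set.univ f) {y : Vec n} (hy : y ∈ X)
    (hmin : IsMinOn (Psi f h) X y) :
    Integrable (fun s => Psi f h (x (R s + 1) s) - Psi f h y) P ∧
      ∫ s, (Psi f h (x (R s + 1) s) - Psi f h y) ∂P ≤
        2 * L * proxFun w dw y x₁ / (N * α) + sigmaTildeSq n M σ μ L / (2 * L * m)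
          + μ ^ 2 * L * n := by
  obtain ⟨h1, -⟩ := sum_integral_norm_projGrad_sq_le hX_closed hX hh hΨ hα hw hproj hF hL hM hμ hx₁
    hm hγ hbatch hsamp horacle hx hG
  have hf := run_isC11 hF hx₁ hsamp horacle
  obtain ⟨hfμ, hgrad⟩ := hf.smoothing (μ := μ)
  have hγ0 := stepsize_pos hα hL hγ
  have hle : ∀ k ∈ Finset.Icc 1 N, k ≤ N + 1 := fun k hk => by
    have := (Finset.mem_Icc.1 hk).2; omega
  have hle' : ∀ k ∈ Finset.Icc 1 N, k + 1 ≤ N + 1 := fun k hk => by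
    have := (Finset.mem_Icc.1 hk).2; omega
  have herr := fun k (hk : k ∈ Finset.Icc 1 N) =>
    run_error_sq hX_closed hX hh hα hw hproj hF hL hM hμ hx₁ hm hγ hbatch hsamp horacle hx hG hk
  have hmem := fun k (hk : k ≤ N + 1) => run_mem hα hproj hL hx₁ hγ hx hk
  have hrun := fun k (hk : k ≤ N + 1) =>
    measurable_run (ξ := ξ) (v := v) hX hh hα hw hproj hF hL hx₁ hγ hx hk
  have hxm := fun k (hk : k ≤ N + 1) => (hrun k hk).mono (hsamp.sampleSigma_le _) le_rfl
  have hclose : ∀ y, |smoothing μ f y - f y| ≤ L / 2 * (μ ^ 2 * n) :=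
    fun y => hf.abs_smoothing_sub_le y
  -- Here the test vector is `x_k - y`. Its square integrability propagates because a step moves by
  -- `γ` times the projected gradient, whose second moment is finite by `h1`.
  have hx2 : ∀ k ≤ N, Integrable (fun s => ‖x (k + 1) s - y‖ ^ 2) P := by
    intro k
    induction k with
    | zero => intro _; simp only [zero_add, run_one hx]; exact integrable_const _
    | succ k ih =>
      intro hk
      have hk' : k + 1 ∈ Finset.Icc 1 N := Finset.mem_Icc.2 ⟨by omega, hk⟩
      have hb : Integrable (fun s => 2 * ‖x (k + 1) s - y‖ ^ 2 + 2 * γ (k + 1) ^ 2 *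
          ‖projGrad X w dw h (x (k + 1) s) (G (k + 1) s) (γ (k + 1))‖ ^ 2) P :=
        ((ih (by omega)).const_mul 2).add ((h1 _ hk').const_mul _)
      refine hb.mono' (((hxm _ (hle' _ hk')).sub_const y).norm.pow_const 2).aestronglyMeasurable
        (Filter.Eventually.of_forall fun s => ?_)
      rw [Real.norm_of_nonneg (by positivity)]
      have e : x (k + 1 + 1) s - y = (x (k + 1) s - y) - γ (k + 1) •
          projGrad X w dw h (x (k + 1) s) (G (k + 1) s) (γ (k + 1)) := by
        rw [run_succ hx hG (by omega), projGrad, smul_smul,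
          mul_one_div_cancel (hγ0 _ hk').ne', one_smul]
        abel
      rw [e]
      have h2 := norm_sub_le (x (k + 1) s - y) (γ (k + 1) •
          projGrad X w dw h (x (k + 1) s) (G (k + 1) s) (γ (k + 1)))
      rw [norm_smul, Real.norm_of_nonneg (hγ0 _ hk').le] at h2
      have h3 := pow_le_pow_left₀ (norm_nonneg _) h2 2
      refine h3.trans ?_
      nlinarith [sq_nonneg (‖x (k + 1) s - y‖ - γ (k + 1) *
        ‖projGrad X w dw h (x (k + 1) s) (G (k + 1) s) (γ (k + 1))‖)]
  have hYm : ∀ k ∈ Finset.Icc 1 N, Measurable[sampleSigma ξ v Set.univ]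
      fun s => Psi f h (x (k + 1) s) - Psi f h y := fun k hk => by
    have hr : Measurable[sampleSigma ξ v Set.univ] (x (k + 1)) :=
      (hrun _ (hle' k hk)).mono (sampleSigma_mono (Set.subset_univ _)) le_rfl
    exact ((hf.continuous.measurable.comp hr).add
      (measurable_comp_run hX hh hα hw hproj hF hL hx₁ hγ hx (hle' k hk))).sub_const _
  have hmain := sum_integral_le_of_sum_le (P := P) (N := N) (d := 1 / (2 * L))
    -- Each step pays `Lμ²n/2` twice for passing from `f_μ` to `f`, once at `y` and once at the new
    -- iterate.
    (K := 2 * L / α * proxFun w dw y x₁ + N * (L * (μ ^ 2 * n)))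
    (A := fun k s => Psi f h (x (k + 1) s) - Psi f h y)
    (D := fun k s => ‖G k s - smoothedGradient μ f (x k s)‖ ^ 2)
    (I := fun k s => inner ℝ (G k s - smoothedGradient μ f (x k s)) (x k s - y))
    (fun s => by
      have h2 : ∑ k ∈ Finset.Icc 1 N, (Psi f h (x (k + 1) s) - Psi f h y) ≤
          ∑ k ∈ Finset.Icc 1 N, (L * (μ ^ 2 * n) -
            2 * L / α * (proxFun w dw y (x (k + 1) s) - proxFun w dw y (x k s)) +
            (1 / (2 * L) * ‖G k s - smoothedGradient μ f (x k s)‖ ^ 2 -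
            inner ℝ (G k s - smoothedGradient μ f (x k s)) (x k s - y))) := by
        refine Finset.sum_le_sum fun k hk => ?_
        have h3 := convex_step hw hX hα hh hproj hL hfμ (hmem k (hle k hk) s) (hγ k hk) (G k s) hy
          (by rw [hgrad]; exact hf.smoothing_add_inner_le hc _ _)
        rw [hgrad, ← run_succ hx hG (Finset.mem_Icc.1 hk).1] at h3
        have h4 := (abs_le.1 (hclose y)).2
        have h5 := (abs_le.1 (hclose (x (k + 1) s))).1
        simp only [Psi] at h3 ⊢
        linarith
      have h3 : ∑ k ∈ Finset.Icc 1 N, (proxFun w dw y (x (k + 1) s) - proxFun w dw y (x k s)) =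
          proxFun w dw y (x (N + 1) s) - proxFun w dw y (x 1 s) := by
        rw [← Finset.Ico_add_one_right_eq_Icc,
          Finset.sum_Ico_sub (fun k => proxFun w dw y (x k s)) (by omega)]
      refine h2.trans ?_
      rw [Finset.sum_add_distrib, Finset.sum_sub_distrib, Finset.sum_const, Nat.card_Icc,
        Nat.add_sub_cancel, nsmul_eq_mul, ← Finset.mul_sum, h3, run_one hx,
        Finset.sum_sub_distrib, ← Finset.mul_sum]
      -- The last prox term of the telescoping sum has a favourable sign and is dropped.
      have h4 : 0 ≤ 2 * L / α * proxFun w dw y (x (N + 1) s) :=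
        mul_nonneg (by positivity) (hw.proxFun_nonneg hX hα hy (hmem _ le_rfl s))
      linarith)
    -- Minimality of `y` enters only here: it makes the gaps nonnegative, hence integrable by
    -- domination.
    (fun k hk s => sub_nonneg.2 (hmin (hmem _ (hle' k hk) s)))
    (fun k hk => (hYm k hk).mono (hsamp.sampleSigma_le _) le_rfl)
    (fun k hk => (herr k hk).1)
    (fun k hk => by
      obtain ⟨j, rfl⟩ := Nat.exists_eq_add_of_le' (Finset.mem_Icc.1 hk).1
      exact run_error_inner hX_closed hX hh hα hw hproj hF hL hM hμ hx₁ hm hγ hbatch hsamp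
        horacle hx hG hk ((hrun _ (hle _ hk)).sub_const y)
        (hx2 j (by have := (Finset.mem_Icc.1 hk).2; omega)))
  obtain ⟨h3, h4⟩ := hsamp.integral_index hα hL hN hγ
    (Y := fun k s => Psi f h (x (k + 1) s) - Psi f h y) hYm hmain.1
  refine ⟨h3, ?_⟩
  rw [h4]
  have hN0 : (0 : ℝ) < N := by exact_mod_cast hN
  have hm0 : (0 : ℝ) < m := by exact_mod_cast hm
  have hS : ∑ k ∈ Finset.Icc 1 N, ∫ s, ‖G k s - smoothedGradient μ f (x k s)‖ ^ 2 ∂P ≤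
      N * (sigmaTildeSq n M σ μ L / m) := by
    refine (Finset.sum_le_card_nsmul _ _ _ fun k hk => (herr k hk).2).trans_eq ?_
    simp
  have h5 : 1 / (N : ℝ) * ∑ k ∈ Finset.Icc 1 N, ∫ s, (Psi f h (x (k + 1) s) - Psi f h y) ∂P ≤
      1 / (N : ℝ) * (2 * L / α * proxFun w dw y x₁ + N * (L * (μ ^ 2 * n)) +
        1 / (2 * L) * (N * (sigmaTildeSq n M σ μ L / m))) := by
    refine mul_le_mul_of_nonneg_left (hmain.2.trans ?_) (by positivity)
    gcongr
  refine h5.trans_eq ?_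
  field_simp
  ring

end Algorithm

end

end RSPGF

theorem mainTheorem9 {n : ℕ} {Ξ Ω : Type*} [MeasurableSpace Ξ] [MeasurableSpace Ω]
    (P : MeasureTheory.Measure Ω) [MeasureTheory.IsProbabilityMeasure P]
    -- the problem `min_{x ∈ X} Ψ(x) = f(x) + h(x)`
    (X : Set (RSPGF.Vec n)) (hX_closed : IsClosed X) (hX_convex : Convex ℝ X)
    (f h : RSPGF.Vec n → ℝ) (hh : ConvexOn ℝ X h)
    (hΨ : BddBelow (RSPGF.Psi f h '' X))
    -- the distance generating function; the generalized projection problem is solvable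
    (α : ℝ) (hα : 0 < α) (w : RSPGF.Vec n → ℝ) (dw : RSPGF.Vec n → RSPGF.Vec n)
    (hw : RSPGF.IsDistanceGenerating X α w dw)
    (hproj : ∀ x ∈ X, ∀ (g : RSPGF.Vec n) (c : ℝ), 0 < c →
      ∃ u, RSPGF.IsGenProj X w dw h x g c u)
    -- the zeroth-order oracle
    (F : RSPGF.Vec n → Ξ → ℝ) (hF : Measurable (Function.uncurry F))
    (L : ℝ) (hL : 0 < L) (σ M : ℝ) (hM : ∀ x ∈ X, ‖gradient f x‖ ≤ M)
    -- the parameters of the algorithm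
    (μ : ℝ) (hμ : 0 < μ) (x₁ : RSPGF.Vec n) (hx₁ : x₁ ∈ X)
    (N : ℕ) (hN : 1 ≤ N) (m : ℕ) (hm : 1 ≤ m)
    (γ : ℕ → ℝ) (hγ : ∀ k ∈ Finset.Icc 1 N, γ k = α / (2 * L))
    (batch : ℕ → ℕ) (hbatch : ∀ k ∈ Finset.Icc 1 N, batch k = m)
    -- the random inputs
    (ξ : ℕ → ℕ → Ω → Ξ) (v : ℕ → ℕ → Ω → RSPGF.Vec n) (R : Ω → ℕ)
    (hsamp : RSPGF.IsSampling P α L γ N ξ v R)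
    (horacle : ∀ k i, RSPGF.IsOracle X f F L σ (P.map (ξ k i)))
    -- the iterates, the batch estimates, and the two projected gradients
    (x : ℕ → Ω → RSPGF.Vec n)
    (hx : x = fun k s => RSPGF.iterate X w dw h F μ γ batch x₁
      (fun j i => ξ j i s) (fun j i => v j i s) k)
    (G : ℕ → Ω → RSPGF.Vec n)
    (hG : G = fun k s => RSPGF.batchEst F μ (batch k) (x k s)
      (fun i => ξ k i s) (fun i => v k i s))
    (gbar g : ℕ → Ω → RSPGF.Vec n)
    (hgbar : gbar = fun k s => RSPGF.projGrad X w dw h (x k s) (G k s) (γ k))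
    (hg : g = fun k s => RSPGF.projGrad X w dw h (x k s) (gradient f (x k s)) (γ k)) :
    (MeasureTheory.Integrable (fun s => ‖gbar (R s) s‖ ^ 2) P ∧
      ∫ s, ‖gbar (R s) s‖ ^ 2 ∂P ≤
        (4 * L ^ 2 * RSPGF.DPsi X f h L x₁ ^ 2 + 4 * μ ^ 2 * L ^ 2 * n) / (α ^ 2 * N)
          + 2 * RSPGF.sigmaTildeSq n M σ μ L / (α ^ 2 * m)) ∧
    (MeasureTheory.Integrable (fun s => ‖g (R s) s‖ ^ 2) P ∧
      ∫ s, ‖g (R s) s‖ ^ 2 ∂P ≤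
        μ ^ 2 * L ^ 2 * ((n : ℝ) + 3) ^ 2 / (2 * α ^ 2)
          + (16 * L ^ 2 * RSPGF.DPsi X f h L x₁ ^ 2 + 16 * μ ^ 2 * L ^ 2 * n) / (α ^ 2 * N)
          + 12 * RSPGF.sigmaTildeSq n M σ μ L / (α ^ 2 * m)) ∧
    (ConvexOn ℝ Set.univ f → ∀ xopt ∈ X, IsMinOn (RSPGF.Psi f h) X xopt →
      MeasureTheory.Integrable
        (fun s => RSPGF.Psi f h (x (R s + 1) s) - RSPGF.Psi f h xopt) P ∧
      ∫ s, (RSPGF.Psi f h (x (R s + 1) s) - RSPGF.Psi f h xopt) ∂P ≤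
        2 * L * RSPGF.proxFun w dw xopt x₁ / (N * α)
          + RSPGF.sigmaTildeSq n M σ μ L / (2 * L * m)
          + μ ^ 2 * L * n) := by
  subst hgbar hg
  refine ⟨?_, ?_, ?_⟩
  · exact RSPGF.integral_norm_randomized_projGrad_sq_le hX_closed hX_convex hh hΨ hα hw hproj hF
      hL hM hμ hx₁ hN hm hγ hbatch hsamp horacle hx hG
  · exact RSPGF.integral_norm_randomized_exact_projGrad_sq_le hX_closed hX_convex hh hΨ hα hw hproj
      hF hL hM hμ hx₁ hN hm hγ hbatch hsamp horacle hx hG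
  · intro hc xopt hopt hmin
    exact RSPGF.integral_randomized_objective_gap_le hX_closed hX_convex hh hΨ hα hw hproj hF hL hM
      hμ hx₁ hN hm hγ hbatch hsamp horacle hx hG hc hopt hmin
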